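/- **Setting.** Let $G$ be a finite loopless graph (parallel edges allowed) with two distinct vertices $s,t$ (the poles) such that $G+st$ is biconnected and planar (an $st$-graph), and let every edge $e$ have a flexibility $\mathrm{flex}(e)\in\mathbb N$. An edge $e$ is *critical* if $\mathrm{flex}(e)=0$ and some endpoint of $e$ has degree $4$ or is a pole of degree at least $2$; $G$ is *$k$-critical* if it has exactly $k$ critical edges. An *orthogonal representation* $\mathcal R$ of $G$ consists of a planar embedding of $G$ with $s$ and $t$ on the outer face, and an integer rotation $\mathrm{rot}(e_f)$, $\mathrm{rot}(v_f)$ for every incidence of an edge $e$ or a vertex $v$ with a face $f$ (multiple incidences are kept apart), such that (1) the rotations in each face sum to $4$, and to $-4$ in the outer face; (2) the two rotations of each edge sum to $0$; (3) the rotations around each vertex $v$ sum to $2\deg(v)-4$; (4) rotations at vertices lie in $[-2,1]$. It is *valid* if $|\mathrm{rot}(e_f)|\le \mathrm{flex}(e)$ always, and a *$(\sigma,\tau)$-orthogonal representation* if $s$ and $t$ have rotations $\sigma-3$ and $\tau-3$ in the outer face. Let $\pi(t,s)$ be the path from $t$ to $s$ along the outer face in counterclockwise direction, and let $\mathrm{rot}(\pi(t,s))$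 be the sum of the rotations, in the outer face along this path, of its edges and its inner vertices. Put $\beta_{\mathrm{low}}=\lceil(\sigma+\tau)/2\rceil-1$. In the double directed dual graph, each edge $e$ with incident faces $g,f$ gives the dual edges $(g,f)$ and $(f,g)$ (loops if $g=f$). The dual edge $e^\star=(g,f)$ is *valid* if (I) $\mathrm{rot}(e_f)<\mathrm{flex}(e)$, or (II) $\mathrm{rot}(v_f)<1$ for an endpoint $v$ of $e$ that is not a pole, where $v_f$ is the incidence next to $e$ on the side of $f$. A *valid cycle* is a simple directed cycle of valid dual edges (a loop is a cycle). *Bending* $\mathcal R$ along it means: for each of its dual edges $(g,f)$, if (I) holds, decrease $\mathrm{rot}(e_g)$ by $1$ and increase $\mathrm{rot}(e_f)$ by $1$; otherwise choose $v$ as in (II), decrease $\mathrm{rot}(v_g)$ by $1$ and increase $\mathrm{rot}(v_f)$ by $1$, where $v_g$ and $v_f$ are the incidences of $v$ next to $e$ on the two sides of $e$. **Statement.** Let $G$ be a $k$-critical $st$-graph and let $\mathcal R$ be a valid $(\sigma,\tau)$-orthogonal representation of $G$. Suppose that - $\sigma+\tau\le 5$ and $-\mathrm{rot}(\pi(t,s))\ge\beta_{\mathrm{low}}+k+1$,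 or - $\sigma=\tau=3$ and $-\mathrm{rot}(\pi(t,s))\ge\beta_{\mathrm{low}}+k+2$. Then there is a valid cycle $C^\star$ such that bending $\mathcal R$ along $C^\star$ (for every admissible choice of the endpoints $v$ in (II)) yields a valid $(\sigma,\tau)$-orthogonal representation in which $-\mathrm{rot}(\pi(t,s))$ is smaller by exactly $1$ than in $\mathcal R$. -/

import Mathlib

/-- A loopless multigraph with vertex type `V` and edge type `E`.  Parallel edges
are allowed.  Each edge `e` has the two endpoints `G.ends e false` and `G.ends e true`; the order of
the endpoints carries no meaning. -/
structure Multigraph (V E : Type*) where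
  ends : E → Bool → V
  loopless : ∀ e, ends e false ≠ ends e true

/-- A dart is an edge together with a direction: `(e, b)` is `e`, leaving its endpoint number `b`. -/
abbrev Dart (E : Type*) := E × Bool

/-- The same edge in the opposite direction. -/
def Dart.rev {E : Type*} : Equiv.Perm (Dart E) where
  toFun d := (d.1, !d.2)
  invFun d := (d.1, !d.2)
  left_inv d := by simp
  right_inv d := by simp

namespace Multigraph

variable {V E : Type*}

/-- The vertex at which a dart starts. -/
def tail (G : Multigraph V E) (d : Dart E) : V := G.ends d.1 d.2

/-- The vertex at which a dart ends. -/
def head (G : Multigraph V E) (d : Dart E) : V := G.tail (Dart.rev d)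

/-- The simple graph that joins two vertices if and only if some edge of `G` does. -/
def toSimpleGraph (G : Multigraph V E) : SimpleGraph V where
  Adj u v := ∃ d : Dart E, G.tail d = u ∧ G.head d = v
  symm := ⟨by
    rintro u v ⟨⟨e, b⟩, rfl, rfl⟩
    exact ⟨(e, !b), by simp [head, tail, Dart.rev], by simp [head, tail, Dart.rev]⟩⟩
  loopless := ⟨by
    rintro v ⟨⟨e, b⟩, h1, h2⟩
    have h := G.loopless e
    cases b <;> simp_all [head, tail, Dart.rev]⟩

/-- `G` is connected and has no cutvertex. -/
def IsBiconnected (G : Multigraph V E) : Prop :=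
  G.toSimpleGraph.Connected ∧
    ∀ v : V, (G.toSimpleGraph.induce {u : V | u ≠ v}).Preconnected

/-- The graph `G + st`: one new edge (called `none`) between `s` and `t`, added even if `s` and `t`
are already adjacent. -/
def addEdge (G : Multigraph V E) (s t : V) (hst : s ≠ t) : Multigraph V (Option E) where
  ends e b := match e with
    | none => if b then t else s
    | some e => G.ends e b
  loopless e := by
    cases e with
    | none => simpa using hst
    | some e => exact G.loopless e

/-- The degree of a vertex. -/
noncomputable def deg (G : Multigraph V E) (v : V) : ℕ := {d : Dart E | G.tail d = v}.ncard

/-- A combinatorial embedding of `G` into an oriented closed surface: `next d` is the dart that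
follows `d` in the counterclockwise order around the tail of `d`.  The darts with a common tail form
one cycle of `next`. -/
structure Embedding (G : Multigraph V E) where
  next : Equiv.Perm (Dart E)
  sameCycle_iff : ∀ d d' : Dart E, next.SameCycle d d' ↔ G.tail d = G.tail d'

namespace Embedding

variable {G : Multigraph V E}

/-- The dart that follows `d` on the boundary of the face to the right of `d`, when this boundary is
traversed with the face to the right. -/
def faceNext (M : G.Embedding) : Equiv.Perm (Dart E) := Dart.rev.trans M.next

/-- The faces are the cycles of `faceNext`. -/
def Face (M : G.Embedding) : Type _ := Quotient (Equiv.Perm.SameCycle.setoid M.faceNext)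

/-- The face to the right of a dart. -/
def face (M : G.Embedding) (d : Dart E) : M.Face :=
  Quotient.mk (Equiv.Perm.SameCycle.setoid M.faceNext) d

/-- Euler's formula `|V| - |E| + |F| = 2`.  For a finite connected graph with at least one edge (the
only case in which this is used) it says that the surface is the sphere. -/
def IsPlanar (M : G.Embedding) : Prop :=
  Nat.card V + Nat.card M.Face = Nat.card E + 2

end Embedding

/-- Planarity, for finite connected graphs with at least one edge. -/
def IsPlanar (G : Multigraph V E) : Prop := ∃ M : G.Embedding, M.IsPlanar

/-- `G` is an `st`-graph with poles `s` and `t`: the graph `G + st` is biconnected and planar. -/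
def IsSTGraph (G : Multigraph V E) (s t : V) : Prop :=
  ∃ hst : s ≠ t, (G.addEdge s t hst).IsBiconnected ∧ (G.addEdge s t hst).IsPlanar

/-- An edge is critical if it is inflexible and one of its endpoints has degree 4 or is a pole of
degree at least 2. -/
def IsCritical (G : Multigraph V E) (s t : V) (flex : E → ℕ) (e : E) : Prop :=
  flex e = 0 ∧ ∃ b : Bool, G.deg (G.ends e b) = 4 ∨
    ((G.ends e b = s ∨ G.ends e b = t) ∧ 2 ≤ G.deg (G.ends e b))

/-- There are exactly `k` critical edges. -/
def IsKCritical (G : Multigraph V E) (s t : V) (flex : E → ℕ) (k : ℕ) : Prop :=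
  {e : E | G.IsCritical s t flex e}.ncard = k

/-- A planar embedding of `G` with a distinguished outer face on which both poles lie.  The outer
face is given by the darts `ds` and `dt` with which its boundary (traversed with the outer face to
the right, that is, counterclockwise around `G`) leaves `s` and `t`; in an `st`-graph each pole
occurs only once on the outer face, so that these darts are determined by the face. -/
structure STEmbedding (G : Multigraph V E) (s t : V) extends G.Embedding where
  planar : toEmbedding.IsPlanar
  ds : Dart E
  dt : Dart E
  tail_ds : G.tail ds = s
  tail_dt : G.tail dt = t
  face_dt : toEmbedding.face dt = toEmbedding.face ds

/-- The outer face. -/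
def STEmbedding.outer {G : Multigraph V E} {s t : V} (M : G.STEmbedding s t) :
    M.toEmbedding.Face :=
  M.face M.ds

/-- A value for each edge-face incidence and each vertex-face incidence.  `edge d` is the rotation
of the edge of `d` in the face to the right of `d`.  `corner d` is the rotation, in the face to the
right of `d`, of the angle at the tail of `d` between `d` and the dart clockwise next to it.  (If a
face meets a vertex or an edge several times, the incidences are kept apart.) -/
@[ext]
structure Rotations (E : Type*) where
  edge : Dart E → ℤ
  corner : Dart E → ℤ

namespace STEmbedding

variable {G : Multigraph V E} {s t : V}

open scoped Classical in
/-- The four defining properties of an orthogonal representation. -/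
structure IsOrthRep [Fintype E] (M : G.STEmbedding s t) (R : Rotations E) : Prop where
  face_sum : ∀ f : M.toEmbedding.Face,
    ∑ d : Dart E with M.face d = f, (R.edge d + R.corner d) = if f = M.outer then -4 else 4
  edge_sum : ∀ d : Dart E, R.edge d + R.edge (Dart.rev d) = 0
  vertex_sum : ∀ v : V, ∑ d : Dart E with G.tail d = v, R.corner d = 2 * (G.deg v : ℤ) - 4
  corner_mem : ∀ d : Dart E, R.corner d ∈ Set.Icc (-2 : ℤ) 1

/-- The representation given by the embedding `M` and the values `R` is a valid (every edge `e` has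
at most `flex e` bends) `(σ, τ)`-orthogonal representation (the poles `s` and `t` have `σ` and `τ`
occupied incidences, respectively). -/
structure IsValidOrthRep [Fintype E] (M : G.STEmbedding s t) (flex : E → ℕ) (σ τ : ℕ)
    (R : Rotations E) : Prop extends M.IsOrthRep R where
  bends_le : ∀ d : Dart E, |R.edge d| ≤ (flex d.1 : ℤ)
  occupied_s : R.corner M.ds = (σ : ℤ) - 3
  occupied_t : R.corner M.dt = (τ : ℤ) - 3

/-- The number of edges of `π(t, s)`. -/
noncomputable def lengthTS (M : G.STEmbedding s t) : ℕ :=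
  sInf {n : ℕ | (M.faceNext ^ n) M.dt = M.ds}

/-- The rotation of `π(t, s)`, the path from `t` to `s` when the outer face is traversed
counterclockwise: the rotations of its edges and of its inner vertices. -/
noncomputable def rotTS (M : G.STEmbedding s t) (R : Rotations E) : ℤ :=
  ∑ i ∈ Finset.range M.lengthTS, R.edge ((M.faceNext ^ i) M.dt) +
    ∑ i ∈ Finset.Ioo 0 M.lengthTS, R.corner ((M.faceNext ^ i) M.dt)

/-! A dart `d` also stands for the dual edge that crosses the edge of `d` from the face `g` on the
right of `d` to the face `f` on its left, which is the face on the right of `Dart.rev d`.  The two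
angles of `g` next to this edge are `d` (at the tail of `d`) and `faceNext d` (at the head of `d`);
those of `f` are `faceNext (Dart.rev d)` (at the tail of `d`) and `Dart.rev d` (at the head of
`d`). -/

/-- What can be changed when bending along a dual edge: the edge that is crossed, or the angles at
the tail or at the head of the dart. -/
inductive Spot
  | edge
  | atTail
  | atHead

/-- The first condition for a dual edge to be valid. -/
def EdgeCond (flex : E → ℕ) (R : Rotations E) (d : Dart E) : Prop :=
  R.edge (Dart.rev d) < (flex d.1 : ℤ)

/-- The second condition for a dual edge to be valid, at the tail of `d`. -/
def TailCond (M : G.STEmbedding s t) (R : Rotations E) (d : Dart E) : Prop :=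
  G.tail d ≠ s ∧ G.tail d ≠ t ∧ R.corner (M.faceNext (Dart.rev d)) < 1

/-- The second condition for a dual edge to be valid, at the head of `d`. -/
def HeadCond (G : Multigraph V E) (s t : V) (R : Rotations E) (d : Dart E) : Prop :=
  G.head d ≠ s ∧ G.head d ≠ t ∧ R.corner (Dart.rev d) < 1

/-- A dual edge is valid if it satisfies one of the two conditions. -/
def IsValidDualEdge (M : G.STEmbedding s t) (flex : E → ℕ) (R : Rotations E) (d : Dart E) : Prop :=
  EdgeCond flex R d ∨ M.TailCond R d ∨ HeadCond G s t R d

/-- A simple directed cycle of valid edges in the double directed dual graph.  Simple means that no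
face is visited twice; a loop is a cycle of length 1. -/
structure IsValidCycle (M : G.STEmbedding s t) (flex : E → ℕ) (R : Rotations E)
    (C : Cycle (Dart E)) : Prop where
  ne_nil : C ≠ Cycle.nil
  chain : C.Chain fun d d' => M.face (Dart.rev d) = M.face d'
  simple : (C.map M.face).Nodup
  valid : ∀ d ∈ C, M.IsValidDualEdge flex R d

/-- The spots at which one may bend along the dual edge `d`: the crossed edge if the first condition
holds; otherwise an endpoint at which the second condition holds. -/
def Admissible (M : G.STEmbedding s t) (flex : E → ℕ) (R : Rotations E) (d : Dart E) :
    Spot → Prop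
  | .edge => EdgeCond flex R d
  | .atTail => ¬ EdgeCond flex R d ∧ M.TailCond R d
  | .atHead => ¬ EdgeCond flex R d ∧ HeadCond G s t R d

/-- A dual edge is valid if and only if there is a spot to bend along it. -/
theorem isValidDualEdge_iff (M : G.STEmbedding s t) (flex : E → ℕ) (R : Rotations E)
    (d : Dart E) : M.IsValidDualEdge flex R d ↔ ∃ p, M.Admissible flex R d p := by
  constructor
  · intro h
    by_cases h1 : EdgeCond flex R d
    · exact ⟨.edge, h1⟩
    · rcases h with h | h | h
      · exact ⟨.edge, h⟩
      · exact ⟨.atTail, h1, h⟩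
      · exact ⟨.atHead, h1, h⟩
  · rintro ⟨_ | _ | _, h⟩
    · exact Or.inl h
    · exact Or.inr (Or.inl h.2)
    · exact Or.inr (Or.inr h.2)

open scoped Classical in
/-- Bending along the dual edge `d` from the face `g` to the face `f`: the rotation of the chosen
edge or vertex is increased by 1 in `f` and reduced by 1 in `g`.  This is the change of the values,
at all edge-face and vertex-face incidences. -/
noncomputable def bendStep (M : G.STEmbedding s t) (d : Dart E) : Spot → Rotations E
  | .edge => ⟨Pi.single (Dart.rev d) 1 - Pi.single d 1, 0⟩
  | .atTail => ⟨0, Pi.single (M.faceNext (Dart.rev d)) 1 - Pi.single d 1⟩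
  | .atHead => ⟨0, Pi.single (Dart.rev d) 1 - Pi.single (M.faceNext d) 1⟩

open scoped Classical in
/-- The result of bending `R` along all dual edges of `C`, at the spots given by `c`. -/
noncomputable def bend [Fintype E] (M : G.STEmbedding s t) (R : Rotations E)
    (C : Cycle (Dart E)) (c : Dart E → Spot) : Rotations E where
  edge := R.edge + ∑ d : Dart E with d ∈ C, (M.bendStep d (c d)).edge
  corner := R.corner + ∑ d : Dart E with d ∈ C, (M.bendStep d (c d)).corner

/-- There is a valid cycle such that bending along it (whichever endpoints are used where there is a
choice) gives a valid `(σ, τ)`-orthogonal representation with `-rot(π(t, s))` reduced by 1. -/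
def ExistsReducingCycle [Fintype E] (M : G.STEmbedding s t) (flex : E → ℕ) (σ τ : ℕ)
    (R : Rotations E) : Prop :=
  ∃ C : Cycle (Dart E), M.IsValidCycle flex R C ∧
    ∀ c : Dart E → Spot, (∀ d ∈ C, M.Admissible flex R d (c d)) →
      M.IsValidOrthRep flex σ τ (M.bend R C c) ∧
        -M.rotTS (M.bend R C c) = -M.rotTS R - 1

end STEmbedding

end Multigraph

/-- The lower bound `⌈(σ + τ) / 2⌉ - 1` on the number of bends. -/
def betaLow (σ τ : ℕ) : ℤ := ⌈((σ : ℚ) + (τ : ℚ)) / 2⌉ - 1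

/-!
The new edge of `G + st` splits the outer face into a part along `π(t, s)` and a part along
`π(s, t)`.  A path of valid dual edges from the second part to the first one, made simple, is a valid
cycle of `G`.  Bending along it preserves all sums over faces and vertices, changes every edge and every
angle by at most 1 and only where there is room, and increases the rotation of `π(t, s)` by 1,
because the cycle enters the outer face through `π(t, s)` and leaves it elsewhere
(`existsReducingCycle_of_list`).

Otherwise, let the barrier `T` be the set of all regions of `G + st` from which the part along
`π(t, s)` can be reached.  It is connected, and no valid dual edge enters it.  Hence, on its boundary,
every edge `e` has rotation `flex e` inside `T`, and at every boundary vertex except the poles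
all angles inside `T` have rotation 1 (`IsBarrier.corner_eq_one`).  Adding the rotations over the
regions of `T` yields an upper bound on `-rot(π(t, s))` in which the numbers of regions, edges and
vertices inside `T` occur only through the Euler characteristic of `T`, which is at most 1
(`IsBarrier.euler`).  What is left are contributions along the boundary (`IsBarrier.neg_rotTS_le`):
`σ + τ - 2`, less the flexibilities of the boundary edges, plus 1 for each boundary vertex of degree 4
that is not a pole.  Each of these vertices is incident to two boundary edges, both flexible or critical.
Double counting shows that the vertices are at most as many as these edges, and fewer if such an edge
ends at a pole, as is the case unless both poles have degree 1 (`fullBoundary_card_le`).  So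
`-rot(π(t, s)) ≤ σ + τ - 3 + k`, or `σ = τ = 1` and `-rot(π(t, s)) ≤ k`, and both contradict the
assumptions.

For the Euler characteristic only the inequality for connected surfaces with nonempty complement is
needed; it is proved by linear algebra, as a statement about the ranks of two orthogonal systems of
gradients (`card_add_card_le_of_connected`).
-/

/-! ### An Euler inequality -/

open scoped Classical in
/-- The Euler characteristic of a connected open subset `T ∪ I ∪ U` of a connected closed surface,
with nonempty complement, is at most 1; here `T`, `I`, `U` are its faces, edges and vertices, `tl` is
the tail of a dart, and `rg` the face next to it.  Indeed, the linear map that sends functions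
`p` on `T` and `q` on `U` to the sum of their gradients on `I`, together with the value `p o`, is
injective: by `htel` the two gradients are orthogonal to each other, so that both vanish if their
sum does. -/
theorem card_add_card_le_of_connected {V E F : Type*} [Fintype E] [DecidableEq F]
    (tl : Dart E → V) (rg : Dart E → F) (T : Finset F) (U : Finset V) (o : F)
    (hT : ∀ p : F → ℝ, (∀ d, rg d ∈ T → rg (Dart.rev d) ∈ T → p (rg d) = p (rg (Dart.rev d))) →
      ∀ r ∈ T, p r = p o)
    (hU : ∀ q : V → ℝ, (∀ v ∉ U, q v = 0) → (∀ d, q (tl d) = q (tl (Dart.rev d))) → q = 0)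
    (hfull : ∀ d, tl d ∈ U → rg d ∈ T ∧ rg (Dart.rev d) ∈ T)
    (htel : ∀ r ∈ T, ∀ q : V → ℝ, (∀ v ∉ U, q v = 0) →
      ∑ d with rg d = r, (q (tl d) - q (tl (Dart.rev d))) = 0) :
    T.card + U.card ≤ Nat.card {e : E // rg (e, false) ∈ T ∧ rg (e, true) ∈ T} + 1 := by
  let eP : (T → ℝ) →ₗ[ℝ] (F → ℝ) := Function.ExtendByZero.linearMap ℝ Subtype.val
  let eQ : (U → ℝ) →ₗ[ℝ] (V → ℝ) := Function.ExtendByZero.linearMap ℝ Subtype.val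
  have eP_mem (p : T → ℝ) (r : T) : eP p r = p r :=
    Subtype.val_injective.extend_apply p 0 r
  have eP_not (p : T → ℝ) (r : F) (hr : r ∉ T) : eP p r = 0 :=
    Function.extend_apply' (f := Subtype.val) p 0 r
      (by rintro ⟨a, rfl⟩; exact hr a.2)
  have eQ_mem (p : U → ℝ) (r : U) : eQ p r = p r :=
    Subtype.val_injective.extend_apply p 0 r
  have eQ_not (p : U → ℝ) (r : V) (hr : r ∉ U) : eQ p r = 0 :=
    Function.extend_apply' (f := Subtype.val) p 0 r
      (by rintro ⟨a, rfl⟩; exact hr a.2)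
  let I := {e : E // rg (e, false) ∈ T ∧ rg (e, true) ∈ T}
  let Φ : ((T → ℝ) × (U → ℝ)) →ₗ[ℝ] ((I → ℝ) × ℝ) :=
    { toFun := fun x =>
        (fun e => (eP x.1 (rg (e.1, false)) - eP x.1 (rg (e.1, true))) +
          (eQ x.2 (tl (e.1, false)) - eQ x.2 (tl (e.1, true))), eP x.1 o)
      map_add' := by
        intro x y
        ext <;> simp only [Prod.fst_add, Prod.snd_add, map_add, Pi.add_apply]
        ring
      map_smul' := by
        intro a x
        ext <;> simp only [Prod.smul_fst, Prod.smul_snd, map_smul, Pi.smul_apply, smul_eq_mul,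
          RingHom.id_apply]
        ring }
  have hinj : Function.Injective Φ := by
    rw [← LinearMap.ker_eq_bot, LinearMap.ker_eq_bot']
    rintro ⟨p, q⟩ h0
    have hPo : eP p o = 0 := congrArg Prod.snd h0
    have hqz := eQ_not q
    set P := eP p with hP
    set Q := eQ q with hQ
    have hedge (d : Dart E) (h1 : rg d ∈ T) (h2 : rg (Dart.rev d) ∈ T) :
        (P (rg d) - P (rg (Dart.rev d))) + (Q (tl d) - Q (tl (Dart.rev d))) = 0 := by
      obtain ⟨e, b⟩ := d
      cases b
      · exact congrFun (congrArg Prod.fst h0) ⟨e, h1, h2⟩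
      · have := congrFun (congrArg Prod.fst h0) ⟨e, h2, h1⟩
        change (P (rg (e, false)) - P (rg (e, true))) +
          (Q (tl (e, false)) - Q (tl (e, true))) = 0 at this
        change (P (rg (e, true)) - P (rg (e, false))) +
          (Q (tl (e, true)) - Q (tl (e, false))) = 0
        linarith
    have hrr (d : Dart E) : Dart.rev (Dart.rev d) = d := by simp [Dart.rev]
    have hout (d : Dart E) (h : ¬ (rg d ∈ T ∧ rg (Dart.rev d) ∈ T)) :
        Q (tl d) - Q (tl (Dart.rev d)) = 0 := by
      rw [hqz _ fun h' => h (hfull d h'), hqz _ fun h' => h (by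
        have := hfull _ h'
        rw [hrr] at this
        exact this.symm), sub_zero]
    -- the gradient of `P` along the dual edges is orthogonal to the gradient of `Q`
    have horth : ∑ d, P (rg d) * (Q (tl d) - Q (tl (Dart.rev d))) = 0 := by
      have h1 : ∑ d, P (rg d) * (Q (tl d) - Q (tl (Dart.rev d))) =
          ∑ d with rg d ∈ T, P (rg d) * (Q (tl d) - Q (tl (Dart.rev d))) := by
        rw [Finset.sum_filter]
        refine Finset.sum_congr rfl fun d _ => ?_
        split_ifs with h
        · rfl
        · rw [hP, eP_not p _ h, zero_mul]
      rw [h1, ← Finset.sum_fiberwise_of_maps_to (t := T) (g := rg) (by simp)]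
      refine Finset.sum_eq_zero fun r hr => ?_
      have h2 : (Finset.univ.filter fun d => rg d ∈ T).filter (fun d => rg d = r) =
          Finset.univ.filter fun d => rg d = r := by
        ext d
        simp only [Finset.mem_filter, Finset.mem_univ, true_and, and_iff_right_iff_imp]
        rintro rfl
        exact hr
      rw [h2, ← mul_zero (P r), ← htel r hr Q hqz, Finset.mul_sum]
      refine Finset.sum_congr rfl fun d hd => ?_
      rw [(Finset.mem_filter.1 hd).2]
    have horth' : ∑ d, P (rg (Dart.rev d)) * (Q (tl d) - Q (tl (Dart.rev d))) = 0 := by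
      rw [← Equiv.sum_comp Dart.rev, ← neg_eq_zero, ← horth, ← Finset.sum_neg_distrib]
      refine Finset.sum_congr rfl fun d _ => ?_
      rw [hrr]
      ring
    -- the two gradients are opposite to each other, so the second one is orthogonal to itself
    have hsq : ∑ d, (Q (tl d) - Q (tl (Dart.rev d))) ^ 2 = 0 := by
      have : ∑ d, (Q (tl d) - Q (tl (Dart.rev d))) ^ 2 =
          ∑ d, P (rg (Dart.rev d)) * (Q (tl d) - Q (tl (Dart.rev d))) -
          ∑ d, P (rg d) * (Q (tl d) - Q (tl (Dart.rev d))) := by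
        rw [← Finset.sum_sub_distrib]
        refine Finset.sum_congr rfl fun d _ => ?_
        by_cases h : rg d ∈ T ∧ rg (Dart.rev d) ∈ T
        · linear_combination (Q (tl d) - Q (tl (Dart.rev d))) * hedge d h.1 h.2
        · rw [hout d h]
          ring
      rw [this, horth, horth', sub_zero]
    have hQ0 (d : Dart E) : Q (tl d) - Q (tl (Dart.rev d)) = 0 :=
      pow_eq_zero_iff two_ne_zero |>.1
        ((Finset.sum_eq_zero_iff_of_nonneg fun d _ => sq_nonneg _).1 hsq d (Finset.mem_univ _))
    have hQz : Q = 0 := hU Q hqz fun d => sub_eq_zero.1 (hQ0 d)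
    have hPz : ∀ r ∈ T, P r = P o := hT P fun d h1 h2 => by
      have := hedge d h1 h2
      rw [hQ0, add_zero] at this
      exact sub_eq_zero.1 this
    refine Prod.ext (funext fun r => ?_) (funext fun v => ?_)
    · change p r = 0
      rw [← eP_mem p r, ← hPo]
      exact hPz r r.2
    · change q v = 0
      rw [← eQ_mem q v]
      exact congrFun hQz v
  have := LinearMap.finrank_le_finrank_of_injective hinj
  simpa [I, Nat.card_eq_fintype_card] using this

/-! ### Darts, faces and the two parts of the outer face -/

theorem Dart.rev_rev {E : Type*} (d : Dart E) : Dart.rev (Dart.rev d) = d := by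
  simp [Dart.rev]

theorem Dart.rev_eq_iff {E : Type*} {d d' : Dart E} : Dart.rev d = d' ↔ d = Dart.rev d' :=
  ⟨fun h => by rw [← h, Dart.rev_rev], fun h => by rw [h, Dart.rev_rev]⟩

namespace Multigraph

variable {V E : Type*} {G : Multigraph V E}

namespace Embedding

variable (M : G.Embedding)

theorem faceNext_rev (d : Dart E) : M.faceNext (Dart.rev d) = M.next d := by
  simp [faceNext, Dart.rev_rev]

theorem tail_next (d : Dart E) : G.tail (M.next d) = G.tail d :=
  ((M.sameCycle_iff _ _).1 ⟨1, by simp⟩).symm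

theorem tail_faceNext (d : Dart E) : G.tail (M.faceNext d) = G.head d := by
  conv_lhs => rw [← Dart.rev_rev d, faceNext_rev, tail_next]
  rfl

theorem face_faceNext (d : Dart E) : M.face (M.faceNext d) = M.face d :=
  Quotient.sound (Equiv.Perm.SameCycle.symm ⟨1, by simp⟩)

theorem face_faceNext_pow (d : Dart E) (n : ℕ) : M.face ((M.faceNext ^ n) d) = M.face d :=
  Quotient.sound (Equiv.Perm.SameCycle.symm ⟨n, by simp⟩)

/-- Induction around a vertex. -/
theorem next_induction [Finite E] {v : V} {P : Dart E → Prop}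
    (h : ∀ d, G.tail d = v → P d → P (M.next d)) {d₀ : Dart E} (hd₀ : G.tail d₀ = v)
    (h₀ : P d₀) {d : Dart E} (hd : G.tail d = v) : P d := by
  obtain ⟨n, rfl⟩ := ((M.sameCycle_iff d₀ d).2 (hd₀.trans hd.symm)).exists_nat_pow_eq
  clear hd
  have : G.tail ((M.next ^ n) d₀) = v ∧ P ((M.next ^ n) d₀) := by
    induction n with
    | zero => exact ⟨hd₀, h₀⟩
    | succ n ih =>
      rw [pow_succ', Equiv.Perm.mul_apply]
      exact ⟨(M.tail_next _).trans ih.1, h _ ih.1 ih.2⟩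
  exact this.2

end Embedding

namespace STEmbedding

variable {s t : V} (M : G.STEmbedding s t)

theorem dt_ne_ds (hst : s ≠ t) : M.dt ≠ M.ds := by
  intro h
  exact hst (M.tail_ds.symm.trans ((congrArg G.tail h).symm.trans M.tail_dt))

theorem faceNext_pow_dt_ne_ds {n : ℕ} (hn : n < M.lengthTS) : (M.faceNext ^ n) M.dt ≠ M.ds :=
  fun h => Nat.notMem_of_lt_sInf hn h

open scoped Classical in
/-- The darts of `π(t, s)`, directed from `t` to `s`. -/
noncomputable def pathTS : Finset (Dart E) :=
  (Finset.range M.lengthTS).image fun i => (M.faceNext ^ i) M.dt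

theorem mem_pathTS {d : Dart E} :
    d ∈ M.pathTS ↔ ∃ i < M.lengthTS, (M.faceNext ^ i) M.dt = d := by
  simp [pathTS]

theorem ds_notMem_pathTS : M.ds ∉ M.pathTS := by
  rw [mem_pathTS]
  rintro ⟨i, hi, h⟩
  exact M.faceNext_pow_dt_ne_ds hi h

open scoped Classical in
/-- The region to the right of a dart in `G + st`, where the new edge splits the outer face in two:
`none` is the part along `π(t, s)`, and `some M.outer` is the other part. -/
noncomputable def region (d : Dart E) : Option M.Face :=
  if d ∈ M.pathTS then none else some (M.face d)

theorem region_eq_none {d : Dart E} : M.region d = none ↔ d ∈ M.pathTS := by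
  simp [region]

theorem region_eq_some {d : Dart E} {f : M.Face} :
    M.region d = some f ↔ d ∉ M.pathTS ∧ M.face d = f := by
  simp [region]

theorem face_of_mem_pathTS {d : Dart E} (h : d ∈ M.pathTS) : M.face d = M.outer := by
  obtain ⟨i, -, rfl⟩ := M.mem_pathTS.1 h
  rw [Embedding.face_faceNext_pow, M.face_dt]
  rfl

theorem region_getD (d : Dart E) : (M.region d).getD M.outer = M.face d := by
  unfold region
  split_ifs with h
  · exact (M.face_of_mem_pathTS h).symm
  · rfl

theorem region_eq_some_iff_face {d : Dart E} {f : M.Face} (hf : f ≠ M.outer) :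
    M.region d = some f ↔ M.face d = f := by
  rw [region_eq_some, and_iff_right_iff_imp]
  rintro rfl h
  exact hf (M.face_of_mem_pathTS h)

theorem region_ds : M.region M.ds = some M.outer :=
  M.region_eq_some.2 ⟨M.ds_notMem_pathTS, rfl⟩

variable [Finite E]

theorem faceNext_pow_lengthTS : (M.faceNext ^ M.lengthTS) M.dt = M.ds := by
  have h : M.faceNext.SameCycle M.dt M.ds := Quotient.exact M.face_dt
  obtain ⟨n, hn⟩ := h.exists_nat_pow_eq
  exact Nat.sInf_mem (s := {n : ℕ | (M.faceNext ^ n) M.dt = M.ds}) ⟨n, hn⟩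

/-- The outer face closes up only after its boundary has passed `s`. -/
theorem faceNext_pow_dt_ne_dt {n : ℕ} (h0 : 0 < n) (hn : n ≤ M.lengthTS) :
    (M.faceNext ^ n) M.dt ≠ M.dt := by
  intro h
  refine M.faceNext_pow_dt_ne_ds (n := M.lengthTS - n) (by omega) ?_
  conv_lhs => rw [← h]
  rw [← Equiv.Perm.mul_apply, ← pow_add, Nat.sub_add_cancel hn, faceNext_pow_lengthTS]

theorem injOn_faceNext_pow_dt :
    Set.InjOn (fun i => (M.faceNext ^ i) M.dt) (Finset.range M.lengthTS) := by
  have key : ∀ i j : ℕ, i < j → j < M.lengthTS →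
      (M.faceNext ^ i) M.dt ≠ (M.faceNext ^ j) M.dt := by
    intro i j hij hj h
    refine M.faceNext_pow_dt_ne_dt (n := j - i) (by omega) (by omega) ?_
    apply (M.faceNext ^ i).injective
    rw [← Equiv.Perm.mul_apply, ← pow_add, Nat.add_sub_cancel' hij.le, h]
  intro i hi j hj h
  simp only [Finset.coe_range, Set.mem_Iio] at hi hj
  rcases lt_trichotomy i j with hij | hij | hij
  · exact (key i j hij hj h).elim
  · exact hij
  · exact (key j i hij hi h.symm).elim

theorem lengthTS_pos (hst : s ≠ t) : 0 < M.lengthTS := by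
  rw [Nat.pos_iff_ne_zero]
  intro h
  have := M.faceNext_pow_lengthTS
  rw [h] at this
  exact M.dt_ne_ds hst this

theorem dt_mem_pathTS (hst : s ≠ t) : M.dt ∈ M.pathTS :=
  M.mem_pathTS.2 ⟨0, M.lengthTS_pos hst, rfl⟩

theorem faceNext_mem_pathTS {d : Dart E} (h1 : M.faceNext d ≠ M.ds) (h2 : M.faceNext d ≠ M.dt) :
    M.faceNext d ∈ M.pathTS ↔ d ∈ M.pathTS := by
  simp only [mem_pathTS]
  constructor
  · rintro ⟨_ | i, hi, h⟩
    · exact (h2 h.symm).elim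
    · refine ⟨i, by omega, M.faceNext.injective ?_⟩
      rw [← h, pow_succ', Equiv.Perm.mul_apply]
  · rintro ⟨i, hi, rfl⟩
    have hs : (M.faceNext ^ (i + 1)) M.dt = M.faceNext ((M.faceNext ^ i) M.dt) := by
      rw [pow_succ', Equiv.Perm.mul_apply]
    refine ⟨i + 1, lt_of_le_of_ne hi fun h => h1 ?_, hs⟩
    rw [← hs, ← M.faceNext_pow_lengthTS]
    exact congrArg (fun n => (M.faceNext ^ n) M.dt) h

theorem mem_pathTS_of_faceNext_eq_ds (hst : s ≠ t) {d : Dart E} (h : M.faceNext d = M.ds) :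
    d ∈ M.pathTS := by
  have h0 := M.lengthTS_pos hst
  refine M.mem_pathTS.2 ⟨M.lengthTS - 1, by omega, M.faceNext.injective ?_⟩
  rw [h, ← Equiv.Perm.mul_apply, ← pow_succ', Nat.sub_add_cancel h0, faceNext_pow_lengthTS]

theorem notMem_pathTS_of_faceNext_eq_dt {d : Dart E} (h : M.faceNext d = M.dt) :
    d ∉ M.pathTS := by
  rintro hd
  obtain ⟨i, hi, rfl⟩ := M.mem_pathTS.1 hd
  refine M.faceNext_pow_dt_ne_dt (n := i + 1) (by omega) (by omega) ?_
  rw [pow_succ', Equiv.Perm.mul_apply, h]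

open scoped Classical in
theorem rotTS_eq_sum_pathTS (hst : s ≠ t) (R : Rotations E) :
    M.rotTS R = ∑ d ∈ M.pathTS, R.edge d + ∑ d ∈ M.pathTS.erase M.dt, R.corner d := by
  have hpos := M.lengthTS_pos hst
  have h1 : M.pathTS.erase M.dt =
      (Finset.Ioo 0 M.lengthTS).image fun i => (M.faceNext ^ i) M.dt := by
    ext d
    simp only [Finset.mem_erase, mem_pathTS, Finset.mem_image, Finset.mem_Ioo]
    constructor
    · rintro ⟨hd, i, hi, rfl⟩
      refine ⟨i, ⟨Nat.pos_of_ne_zero ?_, hi⟩, rfl⟩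
      rintro rfl
      exact hd rfl
    · rintro ⟨i, ⟨h0, hi⟩, rfl⟩
      exact ⟨M.faceNext_pow_dt_ne_dt h0 hi.le, i, hi, rfl⟩
  rw [h1, pathTS, Finset.sum_image M.injOn_faceNext_pow_dt, Finset.sum_image, rotTS]
  refine M.injOn_faceNext_pow_dt.mono fun i hi => ?_
  simp only [Finset.coe_Ioo, Set.mem_Ioo, Finset.coe_range, Set.mem_Iio] at hi ⊢
  exact hi.2

theorem region_dt (hst : s ≠ t) : M.region M.dt = none :=
  M.region_eq_none.2 (M.dt_mem_pathTS hst)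

theorem region_faceNext {d : Dart E} (h1 : M.faceNext d ≠ M.ds) (h2 : M.faceNext d ≠ M.dt) :
    M.region (M.faceNext d) = M.region d := by
  by_cases h : d ∈ M.pathTS
  · rw [M.region_eq_none.2 h, M.region_eq_none.2 ((M.faceNext_mem_pathTS h1 h2).2 h)]
  · rw [M.region_eq_some.2 ⟨h, rfl⟩,
      M.region_eq_some.2 ⟨mt (M.faceNext_mem_pathTS h1 h2).1 h, M.face_faceNext d⟩]

theorem region_of_faceNext_eq_ds (hst : s ≠ t) {d : Dart E} (h : M.faceNext d = M.ds) :
    M.region d = none :=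
  M.region_eq_none.2 (M.mem_pathTS_of_faceNext_eq_ds hst h)

theorem region_of_faceNext_eq_dt {d : Dart E} (h : M.faceNext d = M.dt) :
    M.region d = some M.outer :=
  M.region_eq_some.2 ⟨M.notMem_pathTS_of_faceNext_eq_dt h, by
    rw [← M.face_faceNext, h, M.face_dt]; rfl⟩

/-- At a vertex other than a pole, the angle between two consecutive darts lies in one region of
`G + st`. -/
theorem region_next {d : Dart E} (hs : G.tail d ≠ s) (ht : G.tail d ≠ t) :
    M.region (M.next d) = M.region (Dart.rev d) := by
  rw [← M.faceNext_rev]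
  refine M.region_faceNext (fun h => hs ?_) fun h => ht ?_
  · rw [← M.tail_next, ← M.faceNext_rev, h, M.tail_ds]
  · rw [← M.tail_next, ← M.faceNext_rev, h, M.tail_dt]

end STEmbedding

end Multigraph

/-! ### Bending along a simple dual cycle -/

namespace Multigraph

variable {V E : Type*} {G : Multigraph V E}

namespace STEmbedding

variable {s t : V} (M : G.STEmbedding s t)

/-- The angle at which the rotation is increased when bending along `d` at the given spot. -/
def cornerIn (d : Dart E) : Spot → Option (Dart E)
  | .edge => none
  | .atTail => some (M.faceNext (Dart.rev d))
  | .atHead => some (Dart.rev d)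

/-- The angle at which the rotation is decreased when bending along `d` at the given spot. -/
def cornerOut (d : Dart E) : Spot → Option (Dart E)
  | .edge => none
  | .atTail => some d
  | .atHead => some (M.faceNext d)

variable {M}

theorem face_of_cornerIn {d x : Dart E} {p : Spot} (h : M.cornerIn d p = some x) :
    M.face x = M.face (Dart.rev d) := by
  cases p <;> simp only [cornerIn, Option.some.injEq, reduceCtorEq] at h <;> subst h
  · exact M.face_faceNext _
  · rfl

theorem face_of_cornerOut {d x : Dart E} {p : Spot} (h : M.cornerOut d p = some x) :
    M.face x = M.face d := by
  cases p <;> simp only [cornerOut, Option.some.injEq, reduceCtorEq] at h <;> subst h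
  · rfl
  · exact M.face_faceNext _

theorem exists_cornerIn_of_cornerOut {d x : Dart E} {p : Spot} (h : M.cornerOut d p = some x) :
    ∃ y, M.cornerIn d p = some y ∧ G.tail y = G.tail x := by
  cases p <;> simp only [cornerOut, Option.some.injEq, reduceCtorEq] at h <;> subst h
  · exact ⟨_, rfl, by rw [M.faceNext_rev, M.tail_next]⟩
  · exact ⟨_, rfl, by rw [M.tail_faceNext]; rfl⟩

theorem Admissible.of_cornerIn {flex : E → ℕ} {R : Rotations E} {d x : Dart E} {p : Spot}
    (hp : M.Admissible flex R d p) (h : M.cornerIn d p = some x) :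
    G.tail x ≠ s ∧ G.tail x ≠ t ∧ R.corner x < 1 := by
  cases p <;> simp only [cornerIn, Option.some.injEq, reduceCtorEq] at h <;> subst h
  · refine ⟨?_, ?_, hp.2.2.2⟩ <;> rw [M.faceNext_rev, M.tail_next]
    exacts [hp.2.1, hp.2.2.1]
  · exact hp.2

theorem Admissible.of_cornerOut {flex : E → ℕ} {R : Rotations E} {d x : Dart E} {p : Spot}
    (hp : M.Admissible flex R d p) (h : M.cornerOut d p = some x) :
    G.tail x ≠ s ∧ G.tail x ≠ t := by
  obtain ⟨y, hy, hyx⟩ := exists_cornerIn_of_cornerOut h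
  have := hp.of_cornerIn hy
  rw [← hyx]
  exact ⟨this.1, this.2.1⟩

variable (M)

open scoped Classical in
theorem bendStep_corner (d x : Dart E) (p : Spot) :
    (M.bendStep d p).corner x =
      (if M.cornerIn d p = some x then 1 else 0) - if M.cornerOut d p = some x then 1 else 0 := by
  cases p <;> simp [bendStep, cornerIn, cornerOut, Pi.single_apply, eq_comm]

open scoped Classical in
theorem bendStep_edge (d x : Dart E) (p : Spot) :
    (M.bendStep d p).edge x =
      (if p = .edge ∧ Dart.rev d = x then 1 else 0) - if p = .edge ∧ d = x then 1 else 0 := by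
  cases p <;> simp [bendStep, Pi.single_apply, eq_comm]

theorem bendStep_edge_rev (d x : Dart E) (p : Spot) :
    (M.bendStep d p).edge x + (M.bendStep d p).edge (Dart.rev x) = 0 := by
  have h1 : Dart.rev d = x ↔ d = Dart.rev x := Dart.rev_eq_iff
  have h2 : Dart.rev d = Dart.rev x ↔ d = x := Dart.rev.apply_eq_iff_eq
  rw [bendStep_edge, bendStep_edge]
  split_ifs <;> grind

open scoped Classical in
theorem sum_bendStep_face [Fintype E] (d : Dart E) (p : Spot) (f : M.Face) :
    ∑ x with M.face x = f, ((M.bendStep d p).edge x + (M.bendStep d p).corner x) =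
      (if M.face (Dart.rev d) = f then 1 else 0) - if M.face d = f then 1 else 0 := by
  cases p <;> simp [bendStep, M.face_faceNext]

open scoped Classical in
theorem sum_bendStep_tail [Fintype E] (d : Dart E) (p : Spot) (v : V) :
    ∑ x with G.tail x = v, (M.bendStep d p).corner x = 0 := by
  cases p <;> simp [bendStep, M.faceNext_rev, M.tail_next,
    M.tail_faceNext, head]

open scoped Classical in
/-- The effect of a single bend on the rotation of `π(t, s)`. -/
theorem sum_bendStep_pathTS [Fintype E] {flex : E → ℕ} {R : Rotations E} {d : Dart E} {p : Spot}
    (hp : M.Admissible flex R d p) :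
    ∑ x ∈ M.pathTS, (M.bendStep d p).edge x +
        ∑ x ∈ M.pathTS.erase M.dt, (M.bendStep d p).corner x =
      (if Dart.rev d ∈ M.pathTS then 1 else 0) - if d ∈ M.pathTS then 1 else 0 := by
  have key (y : Dart E) (h1 : G.tail (M.faceNext y) ≠ s) (h2 : G.tail (M.faceNext y) ≠ t) :
      M.faceNext y ∈ M.pathTS.erase M.dt ↔ y ∈ M.pathTS := by
    have h1' : M.faceNext y ≠ M.ds := fun h => h1 (by rw [h, M.tail_ds])
    have h2' : M.faceNext y ≠ M.dt := fun h => h2 (by rw [h, M.tail_dt])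
    rw [Finset.mem_erase, M.faceNext_mem_pathTS h1' h2', and_iff_right h2']
  have key' (y : Dart E) (h2 : G.tail y ≠ t) : y ∈ M.pathTS.erase M.dt ↔ y ∈ M.pathTS := by
    rw [Finset.mem_erase, and_iff_right]
    exact fun h => h2 (by rw [h, M.tail_dt])
  cases p with
  | edge => simp [bendStep]
  | atTail =>
    have h1 := hp.of_cornerIn (x := M.faceNext (Dart.rev d)) rfl
    have h2 := hp.of_cornerOut (x := d) rfl
    simp [bendStep, key _ h1.1 h1.2.1, key' _ h2.2, -Finset.mem_erase]
  | atHead =>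
    have h1 := hp.of_cornerIn (x := Dart.rev d) rfl
    have h2 := hp.of_cornerOut (x := M.faceNext d) rfl
    simp [bendStep, key _ h2.1 h2.2, key' _ h1.2.1, -Finset.mem_erase]

variable {M}

/-- An angle of 360 degrees occurs only at a vertex of degree 1. -/
theorem corner_eq_neg_two [Fintype E] {R : Rotations E} (hR : M.IsOrthRep R) {x y : Dart E}
    (hx : R.corner x = -2) (h : G.tail y = G.tail x) : y = x := by
  classical
  by_contra hne
  have hs := hR.vertex_sum (G.tail x)
  have hdeg : G.deg (G.tail x) = (Finset.univ.filter fun d => G.tail d = G.tail x).card := by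
    rw [deg, ← Set.ncard_coe_finset]
    congr 1
    ext d
    simp
  have hmem : x ∈ Finset.univ.filter fun d => G.tail d = G.tail x := by simp
  have hmem' : y ∈ (Finset.univ.filter fun d => G.tail d = G.tail x).erase x := by simp [hne, h]
  have hle : ∑ d ∈ (Finset.univ.filter fun d => G.tail d = G.tail x).erase x, R.corner d ≤
      ∑ d ∈ (Finset.univ.filter fun d => G.tail d = G.tail x).erase x, 1 :=
    Finset.sum_le_sum fun d _ => (hR.corner_mem d).2
  have hpos := Finset.card_pos.2 ⟨y, hmem'⟩
  have hcard := Finset.card_erase_of_mem hmem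
  rw [← Finset.add_sum_erase _ _ (by convert hmem), hx, hdeg] at hs
  simp only [Finset.sum_const, nsmul_eq_mul, mul_one] at hle
  have : ∑ d ∈ (Finset.univ.filter fun d => G.tail d = G.tail x).erase x, R.corner d =
    2 * ((Finset.univ.filter fun d => G.tail d = G.tail x).card : ℤ) - 2 := by
    linarith
  omega

open scoped Classical in
/-- Let the regions to the right of the darts of a list be distinct, and let these darts lead, one
after the other, from the outer face along `π(s, t)` to the outer face along `π(t, s)`.  Then bending
along the corresponding dual cycle gives a valid representation with a larger rotation of
`π(t, s)`. -/
theorem existsReducingCycle_of_list [Fintype E] (hst : s ≠ t) {flex : E → ℕ} {σ τ : ℕ}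
    {R : Rotations E} (hR : M.IsValidOrthRep flex σ τ R) (a : Dart E) (m : List (Dart E))
    (hstep : (a :: m).map (fun d => M.region (Dart.rev d)) = m.map M.region ++ [none])
    (ha : M.region a = some M.outer) (hnodup : ((a :: m).map M.region).Nodup)
    (hnone : none ∉ (a :: m).map M.region)
    (hvalid : ∀ d ∈ a :: m, M.IsValidDualEdge flex R d) :
    M.ExistsReducingCycle flex σ τ R := by
  have hface : (fun d => (M.region d).getD M.outer) = M.face := funext M.region_getD
  have hfstep : (a :: m).map (fun d => M.face (Dart.rev d)) = m.map M.face ++ [M.face a] := by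
    have := congrArg (List.map fun r => r.getD M.outer) hstep
    simp only [List.map_map, List.map_append, Function.comp_def, M.region_getD] at this
    rw [this]
    have h := M.region_getD a
    rw [ha] at h
    simp [← h]
  have hfnodup : ((a :: m).map M.face).Nodup := by
    have : (a :: m).map M.region = ((a :: m).map M.face).map some := by
      rw [List.map_map]
      refine List.map_congr_left fun d hd => ?_
      have : M.region d ≠ none := fun h => hnone (h ▸ List.mem_map_of_mem hd)
      have h' := M.region_getD d
      obtain ⟨f, hf⟩ := Option.ne_none_iff_exists'.1 this
      rw [hf] at h' ⊢
      simp [← h']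
    rw [this] at hnodup
    exact hnodup.of_map _
  have hperm : ((a :: m).map fun d => M.face (Dart.rev d)).Perm ((a :: m).map M.face) := by
    rw [hfstep]
    exact List.perm_append_singleton _ _
  have hrnodup : ((a :: m).map fun d => M.face (Dart.rev d)).Nodup := hperm.nodup_iff.2 hfnodup
  have hlnodup : (a :: m).Nodup := hfnodup.of_map _
  have hchain : ∀ (m : List (Dart E)) (a b : Dart E),
      (a :: m).map (fun d => M.face (Dart.rev d)) = m.map M.face ++ [M.face b] →
      List.IsChain (fun d d' => M.face (Dart.rev d) = M.face d') (a :: (m ++ [b])) := by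
    intro m
    induction m with
    | nil => intro a b h; simpa using h
    | cons c m ih =>
      intro a b h
      simp only [List.map_cons, List.cons_append, List.cons.injEq] at h
      rw [List.cons_append, List.isChain_cons_cons]
      exact ⟨h.1, ih c b (by simpa using h.2)⟩
  refine ⟨(↑(a :: m) : Cycle (Dart E)), ⟨by simp, ?_, ?_, ?_⟩, ?_⟩
  · rw [Cycle.chain_coe_cons]
    exact hchain m a a hfstep
  · rw [Cycle.map_coe, Cycle.nodup_coe_iff]
    exact hfnodup
  · simpa only [Cycle.mem_coe_iff] using hvalid
  intro c hc
  set D : Finset (Dart E) := (a :: m).toFinset with hD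
  have hmemD (d : Dart E) : d ∈ D ↔ d ∈ a :: m := List.mem_toFinset
  simp only [Cycle.mem_coe_iff] at hc
  replace hc : ∀ d ∈ D, M.Admissible flex R d (c d) := fun d hd => hc d ((hmemD d).1 hd)
  have hfilter : (Finset.univ.filter fun d => d ∈ (↑(a :: m) : Cycle (Dart E))) = D := by
    ext d
    rw [hmemD, Finset.mem_filter, Cycle.mem_coe_iff, and_iff_right (Finset.mem_univ _)]
  have hedge (x : Dart E) : (M.bend R ↑(a :: m) c).edge x =
      R.edge x + ∑ d ∈ D, (M.bendStep d (c d)).edge x := by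
    rw [← hfilter]
    simp [bend, Finset.sum_apply]
  have hcorner (x : Dart E) : (M.bend R ↑(a :: m) c).corner x =
      R.corner x + ∑ d ∈ D, (M.bendStep d (c d)).corner x := by
    rw [← hfilter]
    simp [bend, Finset.sum_apply]
  have hinj : ∀ d ∈ D, ∀ d' ∈ D, M.face d = M.face d' → d = d' := fun d hd d' hd' h =>
    List.inj_on_of_nodup_map hfnodup ((hmemD d).1 hd) ((hmemD d').1 hd') h
  have hinj' : ∀ d ∈ D, ∀ d' ∈ D, M.face (Dart.rev d) = M.face (Dart.rev d') → d = d' :=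
    fun d hd d' hd' h =>
      List.inj_on_of_nodup_map hrnodup ((hmemD d).1 hd) ((hmemD d').1 hd') h
  have hsum (g : Dart E → ℤ) : ∑ d ∈ D, g d = ((a :: m).map g).sum :=
    List.sum_toFinset g hlnodup
  -- `A x` and `B x`: the dual edges for which the rotation at the angle `x` goes up and down; as
  -- the cycle is simple, each of them has at most one element
  set A : Dart E → Finset (Dart E) := fun x => D.filter fun d => M.cornerIn d (c d) = some x
    with hA
  set B : Dart E → Finset (Dart E) := fun x => D.filter fun d => M.cornerOut d (c d) = some x
    with hB
  have hcorner' (x : Dart E) : (M.bend R ↑(a :: m) c).corner x =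
      R.corner x + (A x).card - (B x).card := by
    rw [hcorner, hA, hB, Finset.card_filter, Finset.card_filter]
    simp only [M.bendStep_corner, Finset.sum_sub_distrib]
    push_cast
    ring
  have hA1 (x : Dart E) : (A x).card ≤ 1 := Finset.card_le_one.2 fun d hd d' hd' => by
    rw [hA, Finset.mem_filter] at hd hd'
    exact hinj' d hd.1 d' hd'.1
      ((face_of_cornerIn hd.2).symm.trans (face_of_cornerIn hd'.2))
  have hB1 (x : Dart E) : (B x).card ≤ 1 := Finset.card_le_one.2 fun d hd d' hd' => by
    rw [hB, Finset.mem_filter] at hd hd'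
    exact hinj d hd.1 d' hd'.1
      ((face_of_cornerOut hd.2).symm.trans (face_of_cornerOut hd'.2))
  have hpole (x : Dart E) (hx : G.tail x = s ∨ G.tail x = t) :
      (M.bend R ↑(a :: m) c).corner x = R.corner x := by
    have h1 : A x = ∅ := Finset.filter_eq_empty_iff.2 fun d hd h => by
      have := (hc d hd).of_cornerIn h
      exact hx.elim this.1 this.2.1
    have h2 : B x = ∅ := Finset.filter_eq_empty_iff.2 fun d hd h => by
      have := (hc d hd).of_cornerOut h
      exact hx.elim this.1 this.2
    rw [hcorner', h1, h2]
    simp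
  refine ⟨⟨⟨?_, ?_, ?_, ?_⟩, ?_, ?_, ?_⟩, ?_⟩
  · intro f
    rw [← hR.face_sum f]
    have h1 : ∑ d ∈ D, (if M.face (Dart.rev d) = f then 1 else 0 : ℤ) =
        ∑ d ∈ D, if M.face d = f then 1 else 0 := by
      rw [hsum, hsum]
      have := (hperm.map fun g => if g = f then (1 : ℤ) else 0).sum_eq
      simpa only [List.map_map, Function.comp_def] using this
    simp only [hedge, hcorner]
    rw [← sub_eq_zero, ← Finset.sum_sub_distrib]
    have h2 : ∀ x, R.edge x + ∑ d ∈ D, (M.bendStep d (c d)).edge x +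
        (R.corner x + ∑ d ∈ D, (M.bendStep d (c d)).corner x) - (R.edge x + R.corner x) =
        ∑ d ∈ D, ((M.bendStep d (c d)).edge x + (M.bendStep d (c d)).corner x) := by
      intro x
      rw [Finset.sum_add_distrib]
      ring
    simp only [h2]
    rw [Finset.sum_comm]
    simp only [M.sum_bendStep_face]
    rw [Finset.sum_sub_distrib, h1, sub_self]
  · intro d
    rw [hedge, hedge]
    have : ∑ x ∈ D, (M.bendStep x (c x)).edge d + ∑ x ∈ D, (M.bendStep x (c x)).edge (Dart.rev d)
        = 0 := by
      rw [← Finset.sum_add_distrib]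
      exact Finset.sum_eq_zero fun x _ => M.bendStep_edge_rev x d (c x)
    linarith [hR.edge_sum d]
  · intro v
    simp only [hcorner, Finset.sum_add_distrib]
    rw [Finset.sum_comm]
    simp only [M.sum_bendStep_tail, Finset.sum_const_zero, add_zero]
    exact hR.vertex_sum v
  · intro x
    have h1 := hR.corner_mem x
    have h2 := hA1 x
    have h3 := hB1 x
    rw [Set.mem_Icc] at h1 ⊢
    rw [hcorner']
    have hup : 0 < (A x).card → R.corner x < 1 := fun h => by
      obtain ⟨d, hd⟩ := Finset.card_pos.1 h
      rw [hA, Finset.mem_filter] at hd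
      exact ((hc d hd.1).of_cornerIn hd.2).2.2
    -- at a vertex of degree 1, the angle is both increased and decreased
    have hlow : R.corner x = -2 → 0 < (B x).card → 0 < (A x).card := fun hx h => by
      obtain ⟨d, hd⟩ := Finset.card_pos.1 h
      rw [hB, Finset.mem_filter] at hd
      obtain ⟨y, hy, hyx⟩ := exists_cornerIn_of_cornerOut hd.2
      rw [corner_eq_neg_two hR.toIsOrthRep hx hyx] at hy
      exact Finset.card_pos.2 ⟨d, Finset.mem_filter.2 ⟨hd.1, hy⟩⟩
    omega
  · intro x
    set A' := D.filter fun d => c d = .edge ∧ Dart.rev d = x with hA'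
    set B' := D.filter fun d => c d = .edge ∧ d = x with hB'
    have hx : (M.bend R ↑(a :: m) c).edge x = R.edge x + A'.card - B'.card := by
      rw [hedge, hA', hB', Finset.card_filter, Finset.card_filter]
      simp only [M.bendStep_edge, Finset.sum_sub_distrib]
      push_cast
      ring
    have hA1' : A'.card ≤ 1 := Finset.card_le_one.2 fun d hd d' hd' => by
      rw [hA', Finset.mem_filter] at hd hd'
      exact Dart.rev.injective (hd.2.2.trans hd'.2.2.symm)
    have hB1' : B'.card ≤ 1 := Finset.card_le_one.2 fun d hd d' hd' => by
      rw [hB', Finset.mem_filter] at hd hd'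
      exact hd.2.2.trans hd'.2.2.symm
    have hup : 0 < A'.card → R.edge x < flex x.1 := fun h => by
      obtain ⟨d, hd⟩ := Finset.card_pos.1 h
      rw [hA', Finset.mem_filter] at hd
      obtain ⟨hd, hce, rfl⟩ := hd
      have := hc d hd
      rw [hce] at this
      exact this
    have hlow : 0 < B'.card → - R.edge x < flex x.1 := fun h => by
      obtain ⟨d, hd⟩ := Finset.card_pos.1 h
      rw [hB', Finset.mem_filter] at hd
      obtain ⟨hd, hce, rfl⟩ := hd
      have := hc d hd
      rw [hce] at this
      have h1 : R.edge (Dart.rev d) < flex d.1 := this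
      have h2 := hR.edge_sum d
      linarith
    have h0 := abs_le.1 (hR.bends_le x)
    rw [hx, abs_le]
    omega
  · rw [hpole _ (Or.inl M.tail_ds), hR.occupied_s]
  · rw [hpole _ (Or.inr M.tail_dt), hR.occupied_t]
  · have h1 : ∑ d ∈ D, (if Dart.rev d ∈ M.pathTS then 1 else 0 : ℤ) = 1 := by
      have h0 : ∀ l : List (Dart E), none ∉ l.map M.region →
          (l.map fun d => if M.region d = none then (1 : ℤ) else 0).sum = 0 := by
        intro l hl
        refine List.sum_eq_zero fun z hz => ?_
        obtain ⟨d, hd, rfl⟩ := List.mem_map.1 hz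
        rw [if_neg]
        exact fun h => hl (h ▸ List.mem_map_of_mem hd)
      have := congrArg (fun l => (l.map fun r => if r = none then (1 : ℤ) else 0).sum) hstep
      simp only [List.map_map, List.map_append, Function.comp_def, List.sum_append] at this
      rw [h0 m fun h => hnone (List.mem_cons_of_mem _ h)] at this
      rw [hsum]
      simpa [M.region_eq_none] using this
    have h2 : ∑ d ∈ D, (if d ∈ M.pathTS then 1 else 0 : ℤ) = 0 := by
      refine Finset.sum_eq_zero fun d hd => if_neg fun h => hnone ?_
      rw [← M.region_eq_none.2 h]
      exact List.mem_map_of_mem ((hmemD d).1 hd)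
    rw [M.rotTS_eq_sum_pathTS hst, M.rotTS_eq_sum_pathTS hst]
    simp only [hedge, hcorner, Finset.sum_add_distrib]
    have h3 : ∑ x ∈ M.pathTS, ∑ d ∈ D, (M.bendStep d (c d)).edge x +
        ∑ x ∈ M.pathTS.erase M.dt, ∑ d ∈ D, (M.bendStep d (c d)).corner x = 1 := by
      rw [Finset.sum_comm, Finset.sum_comm (s := M.pathTS.erase M.dt), ← Finset.sum_add_distrib]
      rw [Finset.sum_congr rfl fun d hd => M.sum_bendStep_pathTS (hc d hd),
        Finset.sum_sub_distrib, h1, h2, sub_zero]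
    linarith

/-- `M.Reaches flex R r`: some path of valid dual edges leads from the region `r` to the part of the
outer face along `π(t, s)`. -/
def Reaches (M : G.STEmbedding s t) (flex : E → ℕ) (R : Rotations E) :
    Option M.Face → Prop := fun r =>
  Relation.ReflTransGen
    (fun r r' => ∃ d, M.region d = r ∧ M.region (Dart.rev d) = r' ∧ M.IsValidDualEdge flex R d)
    r none

/-- A path in the dual graph can be made simple: if it returns to the region in which it starts, the
round trip is cut off. -/
theorem Reaches.exists_list {flex : E → ℕ} {R : Rotations E} {r : Option M.Face}
    (h : M.Reaches flex R r) (hr : r ≠ none) : ∃ (a : Dart E) (m : List (Dart E)),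
      (a :: m).map (fun d => M.region (Dart.rev d)) = m.map M.region ++ [none] ∧
      M.region a = r ∧ ((a :: m).map M.region).Nodup ∧ none ∉ (a :: m).map M.region ∧
      ∀ d ∈ a :: m, M.IsValidDualEdge flex R d := by
  induction h using Relation.ReflTransGen.head_induction_on with
  | refl => exact (hr rfl).elim
  | head h1 _ ih =>
    obtain ⟨d, rfl, rfl, hd⟩ := h1
    by_cases h0 : M.region (Dart.rev d) = none
    · exact ⟨d, [], by simp [h0], rfl, by simp, by simpa using hr.symm, by simpa using hd⟩
    obtain ⟨a, m, hstep, ha, hnodup, hnone, hvalid⟩ := ih h0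
    by_cases hmem : M.region d ∈ (a :: m).map M.region
    · obtain ⟨b, hb, hbd⟩ := List.mem_map.1 hmem
      obtain ⟨l₁, l₂, hl⟩ := List.append_of_mem hb
      refine ⟨b, l₂, ?_, hbd, ?_, ?_, ?_⟩
      · have h2 : (a :: m).map (fun d => M.region (Dart.rev d)) =
            ((a :: m).map M.region ++ [none]).tail := by rw [hstep]; simp
        rw [hl] at h2
        have h3 := congrArg (List.drop l₁.length) h2
        rw [List.drop_tail] at h3
        simpa [List.drop_append, List.drop_eq_nil_of_le] using h3
      · rw [hl, List.map_append] at hnodup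
        exact hnodup.of_append_right
      · rw [hl, List.map_append] at hnone
        exact fun h => hnone (List.mem_append_right _ h)
      · exact fun x hx => hvalid x (hl ▸ List.mem_append_right _ hx)
    · refine ⟨d, a :: m, ?_, rfl, ?_, ?_, ?_⟩
      · rw [List.map_cons, hstep, List.map_cons, ha, List.cons_append]
      · rw [List.map_cons, List.nodup_cons]
        exact ⟨hmem, hnodup⟩
      · rw [List.map_cons, List.mem_cons, not_or]
        exact ⟨hr.symm, hnone⟩
      · rintro x (_ | ⟨_, hx⟩)
        exacts [hd, hvalid x hx]

theorem existsReducingCycle_of_reaches [Fintype E] (hst : s ≠ t) {flex : E → ℕ} {σ τ : ℕ}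
    {R : Rotations E} (hR : M.IsValidOrthRep flex σ τ R)
    (h : M.Reaches flex R (some M.outer)) : M.ExistsReducingCycle flex σ τ R := by
  obtain ⟨a, m, hstep, ha, hnodup, hnone, hvalid⟩ := h.exists_list (Option.some_ne_none _)
  exact existsReducingCycle_of_list hst hR a m hstep ha hnodup hnone hvalid

end STEmbedding

end Multigraph

/-! ### The barrier that exists if there is no cycle -/

namespace Multigraph

variable {V E : Type*} {G : Multigraph V E}

theorem deg_eq_card [Fintype E] (v : V) [DecidablePred fun d => G.tail d = v] :
    G.deg v = (Finset.univ.filter fun d => G.tail d = v).card := by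
  rw [deg, ← Set.ncard_coe_finset]
  congr 1
  ext d
  simp

namespace STEmbedding

variable {s t : V} {M : G.STEmbedding s t} {flex : E → ℕ} {R : Rotations E}

/-- A connected set of regions of `G + st` that contains the part of the outer face along `π(t, s)`,
does not contain the other part, and cannot be entered by a valid dual edge. -/
structure IsBarrier (M : G.STEmbedding s t) (flex : E → ℕ) (R : Rotations E)
    (T : Finset (Option M.Face)) : Prop where
  none_mem : none ∈ T
  outer_notMem : some M.outer ∉ T
  connected : ∀ p : Option M.Face → ℝ, (∀ d, M.region d ∈ T → M.region (Dart.rev d) ∈ T →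
    p (M.region d) = p (M.region (Dart.rev d))) → ∀ r ∈ T, p r = p none
  boundary : ∀ d, M.region d ∈ T → M.region (Dart.rev d) ∉ T →
    ¬ M.IsValidDualEdge flex R (Dart.rev d)

/-- If the outer part along `π(s, t)` does not reach the one along `π(t, s)`, then the regions that
do reach the latter form a barrier. -/
theorem exists_isBarrier [Finite E] (h : ¬ M.Reaches flex R (some M.outer)) :
    ∃ T, M.IsBarrier flex R T := by
  classical
  have : Finite M.Face := Quotient.finite _
  have := Fintype.ofFinite (Option M.Face)
  refine ⟨Finset.univ.filter (M.Reaches flex R), ?_, ?_, ?_, ?_⟩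
  · exact Finset.mem_filter.2 ⟨Finset.mem_univ _, Relation.ReflTransGen.refl⟩
  · simpa using h
  · intro p hp r hr
    replace hr : M.Reaches flex R r := by simpa using hr
    induction hr using Relation.ReflTransGen.head_induction_on with
    | refl => rfl
    | head h1 h2 ih =>
      rw [← ih]
      obtain ⟨d, rfl, rfl, hd⟩ := h1
      refine hp d ?_ ?_
      · exact Finset.mem_filter.2
          ⟨Finset.mem_univ _, Relation.ReflTransGen.head ⟨d, rfl, rfl, hd⟩ h2⟩
      · exact Finset.mem_filter.2 ⟨Finset.mem_univ _, h2⟩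
  · intro d h1 h2 h3
    simp only [Finset.mem_filter, Finset.mem_univ, true_and] at h1 h2
    exact h2 (Relation.ReflTransGen.head ⟨_, rfl, by rw [Dart.rev_rev], h3⟩ h1)

section Local

variable {T : Finset (Option M.Face)}

theorem exists_leaving [Finite E] {d d' : Dart E} (hs : G.tail d ≠ s) (ht : G.tail d ≠ t)
    (hd : M.region d ∈ T) (hd' : M.region d' ∉ T) (h : G.tail d' = G.tail d) :
    ∃ e, G.tail e = G.tail d ∧ M.region e ∈ T ∧ M.region (Dart.rev e) ∉ T := by
  by_contra! hc
  refine hd' (M.next_induction (v := G.tail d) (P := fun x => M.region x ∈ T)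
    (fun x hx hx' => ?_) rfl hd h)
  rw [M.region_next (hx ▸ hs) (hx ▸ ht)]
  exact hc x hx hx'

theorem exists_entering [Finite E] {d d' : Dart E} (hs : G.tail d ≠ s) (ht : G.tail d ≠ t)
    (hd : M.region d ∈ T) (hd' : M.region d' ∉ T) (h : G.tail d' = G.tail d) :
    ∃ e, G.tail e = G.tail d ∧ M.region e ∉ T ∧ M.region (Dart.rev e) ∈ T := by
  by_contra! hc
  refine M.next_induction (v := G.tail d) (P := fun x => M.region x ∉ T)
    (fun x hx hx' => ?_) h hd' rfl hd
  rw [M.region_next (hx ▸ hs) (hx ▸ ht)]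
  exact hc x hx hx'

variable [Fintype E]

open scoped Classical in
/-- If there are four angles at a vertex, each of them is a right angle. -/
theorem corner_eq_one_of_four_le (hR : M.IsOrthRep R) {d : Dart E}
    (h : 4 ≤ G.deg (G.tail d)) : R.corner d = 1 := by
  have hs := hR.vertex_sum (G.tail d)
  have hmem : d ∈ Finset.univ.filter fun x => G.tail x = G.tail d := by simp
  have hle : ∑ x ∈ (Finset.univ.filter fun x => G.tail x = G.tail d).erase d, R.corner x ≤
      ∑ x ∈ (Finset.univ.filter fun x => G.tail x = G.tail d).erase d, 1 :=
    Finset.sum_le_sum fun x _ => (hR.corner_mem x).2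
  rw [← Finset.add_sum_erase _ _ hmem] at hs
  rw [Finset.sum_const, Finset.card_erase_of_mem hmem, ← deg_eq_card, nsmul_one,
    Nat.cast_sub (by omega)] at hle
  have := (hR.corner_mem d).2
  push_cast at hle
  linarith [(Nat.cast_le (α := ℤ)).2 h]

open scoped Classical in
theorem deg_le_four (hR : M.IsOrthRep R) (v : V) : G.deg v ≤ 4 := by
  have hs := hR.vertex_sum v
  have hle : ∑ x with G.tail x = v, R.corner x ≤ ∑ x with G.tail x = v, 1 :=
    Finset.sum_le_sum fun x _ => (hR.corner_mem x).2
  rw [Finset.sum_const, ← deg_eq_card, nsmul_one] at hle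
  omega

/-- The edges on the boundary of a barrier have as many bends as possible. -/
theorem IsBarrier.edge_eq (hT : M.IsBarrier flex R T) {σ τ : ℕ}
    (hR : M.IsValidOrthRep flex σ τ R) {d : Dart E} (h1 : M.region d ∈ T)
    (h2 : M.region (Dart.rev d) ∉ T) : R.edge d = flex d.1 := by
  refine le_antisymm ((le_abs_self _).trans (hR.bends_le d)) (not_lt.1 fun h => ?_)
  refine hT.boundary d h1 h2 (Or.inl ?_)
  rw [EdgeCond, Dart.rev_rev]
  exact h

theorem IsBarrier.corner_eq (hT : M.IsBarrier flex R T) (hR : M.IsOrthRep R) {d : Dart E}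
    (hs : G.tail d ≠ s) (ht : G.tail d ≠ t) (h1 : M.region d ∈ T)
    (h2 : M.region (Dart.rev d) ∉ T) : R.corner d = 1 := by
  refine le_antisymm (hR.corner_mem d).2 (not_lt.1 fun h => ?_)
  refine hT.boundary d h1 h2 (Or.inr (Or.inr ?_))
  rw [HeadCond, head, Dart.rev_rev]
  exact ⟨hs, ht, h⟩

theorem IsBarrier.corner_next_eq (hT : M.IsBarrier flex R T) (hR : M.IsOrthRep R) {d : Dart E}
    (hs : G.tail d ≠ s) (ht : G.tail d ≠ t) (h1 : M.region d ∉ T)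
    (h2 : M.region (Dart.rev d) ∈ T) : R.corner (M.next d) = 1 := by
  refine le_antisymm (hR.corner_mem _).2 (not_lt.1 fun h => ?_)
  have hb := hT.boundary (Dart.rev d) h2 (by rwa [Dart.rev_rev])
  rw [Dart.rev_rev] at hb
  refine hb (Or.inr (Or.inl ?_))
  rw [TailCond, M.faceNext_rev]
  exact ⟨hs, ht, h⟩

open scoped Classical in
/-- At a non-pole vertex on the boundary of a barrier, all angles inside of the barrier are right
angles: if such an angle is next to the boundary, bending would be possible otherwise, and if it is
not, there are at least four angles at the vertex. -/
theorem IsBarrier.corner_eq_one (hT : M.IsBarrier flex R T) (hR : M.IsOrthRep R) {d d' : Dart E}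
    (hs : G.tail d ≠ s) (ht : G.tail d ≠ t) (hd : M.region d ∈ T) (hd' : M.region d' ∉ T)
    (h : G.tail d' = G.tail d) : R.corner d = 1 := by
  by_cases h1 : M.region (Dart.rev d) ∈ T
  swap
  · exact hT.corner_eq hR hs ht hd h1
  obtain ⟨e, rfl⟩ := M.next.surjective d
  have hte : G.tail (M.next e) = G.tail e := M.tail_next e
  have hrev : M.region (Dart.rev e) ∈ T := by
    rw [← M.region_next (hte ▸ hs) (hte ▸ ht)]
    exact hd
  by_cases h2 : M.region e ∈ T
  swap
  · exact hT.corner_next_eq hR (hte ▸ hs) (hte ▸ ht) h2 hrev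
  rw [← M.region_next hs ht] at h1
  apply corner_eq_one_of_four_le hR
  have hne1 : M.next e ≠ e := by
    intro h3
    have := M.next_induction (v := G.tail e) (P := fun x => x = e)
      (fun x _ hx => by rw [hx, h3]) rfl rfl (h.trans hte)
    exact hd' (this ▸ h2)
  have hne2 : M.next (M.next e) ≠ M.next e := fun h3 => hne1 (M.next.injective h3)
  have hne3 : M.next (M.next e) ≠ e := by
    intro h3
    have := M.next_induction (v := G.tail e) (P := fun x => x = e ∨ x = M.next e)
      (fun x _ hx => by
        rcases hx with rfl | rfl
        · exact Or.inr rfl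
        · exact Or.inl h3) rfl (Or.inl rfl) (h.trans hte)
    rcases this with rfl | rfl
    exacts [hd' h2, hd' hd]
  rw [deg_eq_card]
  have hsub : ({e, M.next e, M.next (M.next e), d'} : Finset (Dart E)) ⊆
      Finset.univ.filter fun x => G.tail x = G.tail (M.next e) := by
    intro x hx
    simp only [Finset.mem_insert, Finset.mem_singleton] at hx
    rw [Finset.mem_filter]
    rcases hx with rfl | rfl | rfl | rfl
    exacts [⟨Finset.mem_univ _, hte.symm⟩, ⟨Finset.mem_univ _, rfl⟩,
      ⟨Finset.mem_univ _, M.tail_next _⟩, ⟨Finset.mem_univ _, h⟩]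
  refine le_of_eq_of_le ?_ (Finset.card_le_card hsub)
  have hx : ∀ x, M.region x ∈ T → x ≠ d' := fun x hx hxd => hd' (hxd ▸ hx)
  rw [Finset.card_insert_of_notMem, Finset.card_insert_of_notMem, Finset.card_insert_of_notMem,
    Finset.card_singleton]
  · simpa only [Finset.mem_singleton] using hx _ h1
  · simpa only [Finset.mem_insert, Finset.mem_singleton, not_or] using ⟨hne2.symm, hx _ hd⟩
  · simpa only [Finset.mem_insert, Finset.mem_singleton, not_or] using
      ⟨hne1.symm, hne3.symm, hx _ h2⟩

/-- The boundary of a barrier has an edge at `s`. -/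
theorem IsBarrier.exists_boundary_s (hT : M.IsBarrier flex R T) (hst : s ≠ t) :
    ∃ e, G.tail e = s ∧ ¬ (M.region e ∈ T ↔ M.region (Dart.rev e) ∈ T) := by
  by_contra! hc
  -- otherwise, all darts at `s` are on the same side as `ds`, but the last one ends `π(t, s)`
  obtain ⟨p, hp⟩ := M.next.surjective M.ds
  have htp : G.tail p = s := by rw [← M.tail_next, hp, M.tail_ds]
  have h1 : M.region p ∈ T := by
    rw [hc p htp, M.region_of_faceNext_eq_ds hst ((M.faceNext_rev p).trans hp)]
    exact hT.none_mem
  refine M.next_induction (v := s) (P := fun x => M.region x ∉ T)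
    (fun x hx hx' => ?_) M.tail_ds (M.region_ds ▸ hT.outer_notMem) htp h1
  by_cases h2 : M.next x = M.ds
  · rw [h2, M.region_ds]
    exact hT.outer_notMem
  · rw [← M.faceNext_rev, M.region_faceNext, ← hc x hx]
    · exact hx'
    · rwa [M.faceNext_rev]
    · rw [M.faceNext_rev]
      intro h3
      have := M.tail_next x
      rw [h3, M.tail_dt, hx] at this
      exact hst this.symm

/-- The boundary of a barrier has an edge at `t`. -/
theorem IsBarrier.exists_boundary_t (hT : M.IsBarrier flex R T) (hst : s ≠ t) :
    ∃ e, G.tail e = t ∧ ¬ (M.region e ∈ T ↔ M.region (Dart.rev e) ∈ T) := by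
  by_contra! hc
  -- otherwise, all darts at `t` are on the same side as `dt`, but the last one ends `π(s, t)`
  obtain ⟨p, hp⟩ := M.next.surjective M.dt
  have htp : G.tail p = t := by rw [← M.tail_next, hp, M.tail_dt]
  have h1 : M.region p ∉ T := by
    rw [hc p htp, M.region_of_faceNext_eq_dt ((M.faceNext_rev p).trans hp)]
    exact hT.outer_notMem
  refine h1 (M.next_induction (v := t) (P := fun x => M.region x ∈ T)
    (fun x hx hx' => ?_) M.tail_dt (M.region_dt hst ▸ hT.none_mem) htp)
  by_cases h2 : M.next x = M.dt
  · rw [h2, M.region_dt hst]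
    exact hT.none_mem
  · rw [← M.faceNext_rev, M.region_faceNext, ← hc x hx]
    · exact hx'
    · rw [M.faceNext_rev]
      intro h3
      have := M.tail_next x
      rw [h3, M.tail_ds, hx] at this
      exact hst this
    · rwa [M.faceNext_rev]

end Local

section Global

variable [Fintype E] {T : Finset (Option M.Face)}

open scoped Classical in
/-- Sum of the rotations over the faces of a barrier. -/
theorem IsBarrier.sum_region (hT : M.IsBarrier flex R T) (hR : M.IsOrthRep R) (hst : s ≠ t) :
    ∑ d with M.region d ∈ T, (R.edge d + R.corner d) =
      4 * ((T.card : ℤ) - 1) + M.rotTS R + R.corner M.dt := by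
  rw [← Finset.sum_fiberwise_of_maps_to (t := T) (g := M.region) (by simp)]
  have h1 : ∀ r ∈ T, (Finset.univ.filter fun d => M.region d ∈ T).filter (fun d => M.region d = r) =
      Finset.univ.filter fun d => M.region d = r := by
    intro r hr
    ext d
    simp only [Finset.mem_filter, Finset.mem_univ, true_and, and_iff_right_iff_imp]
    rintro rfl
    exact hr
  rw [Finset.sum_congr rfl fun r hr => by rw [h1 r hr], ← Finset.sum_erase_add _ _ hT.none_mem]
  have h2 : ∀ r ∈ T.erase none, ∑ d with M.region d = r, (R.edge d + R.corner d) = 4 := by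
    intro r hr
    obtain ⟨hr0, hr⟩ := Finset.mem_erase.1 hr
    obtain ⟨f, rfl⟩ := Option.ne_none_iff_exists'.1 hr0
    have hf : f ≠ M.outer := fun h => hT.outer_notMem (h ▸ hr)
    have := hR.face_sum f
    rw [if_neg hf] at this
    simpa only [M.region_eq_some_iff_face hf] using this
  have h3 : (Finset.univ.filter fun d => M.region d = none) = M.pathTS := by
    ext d
    simp [M.region_eq_none]
  rw [Finset.sum_congr rfl h2, h3, Finset.sum_const, Finset.card_erase_of_mem hT.none_mem,
    M.rotTS_eq_sum_pathTS hst, Finset.sum_add_distrib,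
    ← Finset.sum_erase_add _ R.corner (M.dt_mem_pathTS hst), nsmul_eq_mul,
    Nat.cast_sub (Finset.card_pos.2 ⟨_, hT.none_mem⟩)]
  push_cast
  ring

open scoped Classical in
/-- The vertices in the interior of a set of regions. -/
noncomputable def interior [Fintype V] (M : G.STEmbedding s t) (T : Finset (Option M.Face)) :
    Finset V :=
  Finset.univ.filter fun v => v ≠ s ∧ v ≠ t ∧ ∀ d, G.tail d = v → M.region d ∈ T

open scoped Classical in
/-- A barrier is a connected surface with nonempty complement, and therefore has Euler
characteristic at most 1. -/
theorem IsBarrier.euler [Fintype V] (hT : M.IsBarrier flex R T) (hst : s ≠ t)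
    (hG : (G.addEdge s t hst).toSimpleGraph.Connected) :
    T.card + (M.interior T).card ≤
      Nat.card {e : E // M.region (e, false) ∈ T ∧ M.region (e, true) ∈ T} + 1 := by
  have hsU : s ∉ M.interior T := by simp [interior]
  have htU : t ∉ M.interior T := by simp [interior]
  refine card_add_card_le_of_connected G.tail M.region T (M.interior T) none hT.connected
    ?_ ?_ ?_
  · intro q hq0 hq
    have hadj : ∀ u v, (G.addEdge s t hst).toSimpleGraph.Adj u v → q u = q v := by
      rintro _ _ ⟨⟨_ | e, b⟩, rfl, rfl⟩
      · cases b <;> simp [tail, head, addEdge, Dart.rev, hq0 s hsU, hq0 t htU]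
      · exact hq (e, b)
    funext v
    obtain ⟨p⟩ := hG.preconnected v s
    have : ∀ u w, (G.addEdge s t hst).toSimpleGraph.Walk u w → q u = q w := by
      intro u w p
      induction p with
      | nil => rfl
      | cons h _ ih => exact (hadj _ _ h).trans ih
    rw [this v s p, hq0 s hsU]
    rfl
  · intro d hd
    simp only [interior, Finset.mem_filter, Finset.mem_univ, true_and] at hd
    refine ⟨hd.2.2 d rfl, ?_⟩
    rw [← M.region_next hd.1 hd.2.1]
    exact hd.2.2 _ (M.tail_next d)
  · intro r hr q hq
    have htail (d : Dart E) : G.tail (Dart.rev d) = G.tail (M.faceNext d) :=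
      (M.tail_faceNext d).symm
    simp only [htail]
    rcases r with _ | f
    · have h3 : (Finset.univ.filter fun d => M.region d = none) = M.pathTS := by
        ext d
        simp [M.region_eq_none]
      rw [h3, pathTS, Finset.sum_image M.injOn_faceNext_pow_dt]
      have := Finset.sum_range_sub' (fun i => q (G.tail ((M.faceNext ^ i) M.dt))) M.lengthTS
      simp only [pow_succ', Equiv.Perm.mul_apply, M.faceNext_pow_lengthTS, M.tail_ds, pow_zero,
        Equiv.Perm.one_apply, M.tail_dt, hq s hsU, hq t htU, sub_zero] at this
      exact this
    · have hf : f ≠ M.outer := fun h => hT.outer_notMem (h ▸ hr)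
      simp only [M.region_eq_some_iff_face hf]
      rw [Finset.sum_sub_distrib, sub_eq_zero]
      symm
      refine Finset.sum_equiv M.faceNext (fun d => ?_) fun d _ => rfl
      simp [M.face_faceNext]

end Global

end STEmbedding

end Multigraph

/-! ### Counting along the boundary of the barrier -/

namespace Multigraph

variable {V E : Type*} {G : Multigraph V E}

namespace STEmbedding

variable {s t : V} {M : G.STEmbedding s t} {flex : E → ℕ} {R : Rotations E}
  {T : Finset (Option M.Face)}

open scoped Classical in
/-- The indicator function of the darts with a region of `T` to the right. -/
noncomputable def inside (M : G.STEmbedding s t) (T : Finset (Option M.Face)) (d : Dart E) : ℤ :=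
  if M.region d ∈ T then 1 else 0

open scoped Classical in
/-- The indicator function of the darts with a region of `T` to the right, and another region to the
left. -/
noncomputable def leaving (M : G.STEmbedding s t) (T : Finset (Option M.Face)) (d : Dart E) : ℤ :=
  if M.region d ∈ T ∧ M.region (Dart.rev d) ∉ T then 1 else 0

/-- The indicator function of the darts on the boundary of `T`, in either direction. -/
noncomputable def crossing (M : G.STEmbedding s t) (T : Finset (Option M.Face)) (d : Dart E) : ℤ :=
  M.leaving T d + M.leaving T (Dart.rev d)

theorem leaving_nonneg (d : Dart E) : 0 ≤ M.leaving T d := by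
  unfold leaving
  split_ifs <;> norm_num

theorem crossing_nonneg (d : Dart E) : 0 ≤ M.crossing T d :=
  add_nonneg (leaving_nonneg d) (leaving_nonneg _)

theorem crossing_eq_zero {d : Dart E} (h : M.region d ∈ T ↔ M.region (Dart.rev d) ∈ T) :
    M.crossing T d = 0 := by
  simp [crossing, leaving, Dart.rev_rev, h]

theorem crossing_eq_one {d : Dart E} (h : ¬ (M.region d ∈ T ↔ M.region (Dart.rev d) ∈ T)) :
    M.crossing T d = 1 := by
  unfold crossing leaving
  rw [Dart.rev_rev]
  split_ifs <;> first | rfl | (exfalso; tauto)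

variable [Fintype E]

theorem sum_crossing_mul (g : E → ℤ) :
    ∑ d, M.crossing T d * g d.1 = 2 * ∑ d, M.leaving T d * g d.1 := by
  have h : ∑ d, M.leaving T (Dart.rev d) * g d.1 = ∑ d, M.leaving T d * g d.1 :=
    Equiv.sum_comp Dart.rev fun d => M.leaving T d * g d.1
  simp only [crossing, add_mul, Finset.sum_add_distrib, h, two_mul]

theorem sum_leaving_mul_le {g : E → ℤ} (hg : ∀ e, 0 ≤ g e) :
    ∑ d, M.leaving T d * g d.1 ≤ ∑ e, g e := by
  rw [Fintype.sum_prod_type]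
  refine Finset.sum_le_sum fun e _ => ?_
  rw [Fintype.sum_bool, ← add_mul]
  refine mul_le_of_le_one_left (hg e) ?_
  have h1 : Dart.rev (e, true) = (e, false) := rfl
  have h2 : Dart.rev (e, false) = (e, true) := rfl
  by_cases h : M.region (e, true) ∈ T <;> by_cases h' : M.region (e, false) ∈ T <;>
    simp [leaving, h1, h2, h, h']

open scoped Classical in
/-- The contribution of a vertex to the bound on the rotation of `π(t, s)`.  Each angle inside of `T`
contributes 2 from Euler's inequality, less its rotation; each boundary edge costs 1 at each of its
ends, and an interior vertex costs 4. -/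
noncomputable def defect [Fintype V] (M : G.STEmbedding s t) (R : Rotations E)
    (T : Finset (Option M.Face)) (v : V) : ℤ :=
  (∑ d with G.tail d = v, (M.inside T d * (2 - R.corner d) - M.crossing T d)) -
    4 * if v ∈ M.interior T then 1 else 0

open scoped Classical in
/-- Summing the rotations over the regions of a barrier bounds the rotation of `π(t, s)` by local
contributions of the vertices and of the boundary edges. -/
theorem IsBarrier.neg_rotTS_le [Fintype V] (hT : M.IsBarrier flex R T) {σ τ : ℕ}
    (hR : M.IsValidOrthRep flex σ τ R) (hst : s ≠ t)
    (hG : (G.addEdge s t hst).toSimpleGraph.Connected) :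
    -M.rotTS R ≤ (τ : ℤ) - 3 - ∑ d, M.leaving T d * (flex d.1 : ℤ) + ∑ v, M.defect R T v := by
  set i : Dart E → ℤ := fun d => if M.region d ∈ T ∧ M.region (Dart.rev d) ∈ T then 1 else 0
    with hi
  have hin : ∀ d, M.inside T d = i d + M.leaving T d := by
    intro d
    simp only [inside, hi, leaving]
    split_ifs <;> first | rfl | (exfalso; tauto)
  have hirev : ∀ d, i (Dart.rev d) = i d := by
    intro d
    simp only [hi, Dart.rev_rev, and_comm]
  have hedge : ∑ d, M.inside T d * R.edge d = ∑ d, M.leaving T d * (flex d.1 : ℤ) := by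
    have h1 : ∑ d, i d * R.edge d = 0 := by
      have h2 : ∑ d, i d * R.edge d = - ∑ d, i d * R.edge d := by
        conv_lhs => rw [← Equiv.sum_comp Dart.rev]
        rw [← Finset.sum_neg_distrib]
        refine Finset.sum_congr rfl fun d _ => ?_
        rw [hirev]
        linear_combination i d * hR.edge_sum d
      linarith
    simp only [hin, add_mul, Finset.sum_add_distrib, h1, zero_add]
    refine Finset.sum_congr rfl fun d _ => ?_
    by_cases h : M.region d ∈ T ∧ M.region (Dart.rev d) ∉ T
    · rw [hT.edge_eq hR h.1 h.2]
    · simp [leaving, h]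
  have hface := hT.sum_region hR.toIsOrthRep hst
  rw [hR.occupied_t, Finset.sum_filter] at hface
  have hface' : ∑ d, M.inside T d * R.edge d + ∑ d, M.inside T d * R.corner d =
      4 * ((T.card : ℤ) - 1) + M.rotTS R + ((τ : ℤ) - 3) := by
    rw [← hface, ← Finset.sum_add_distrib]
    refine Finset.sum_congr rfl fun d _ => ?_
    unfold inside
    split_ifs <;> ring
  have heuler := (Nat.cast_le (α := ℤ)).2 (hT.euler hst hG)
  push_cast at heuler
  have hcard : ∑ d, i d =
      2 * (Nat.card {e : E // M.region (e, false) ∈ T ∧ M.region (e, true) ∈ T} : ℤ) := by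
    rw [Fintype.sum_prod_type, Nat.card_eq_fintype_card, Fintype.card_subtype,
      Finset.card_filter, Nat.cast_sum, Finset.mul_sum]
    refine Finset.sum_congr rfl fun e _ => ?_
    rw [Fintype.sum_bool]
    have h1 : Dart.rev (e, true) = (e, false) := rfl
    have h2 : Dart.rev (e, false) = (e, true) := rfl
    by_cases h : M.region (e, true) ∈ T <;> by_cases h' : M.region (e, false) ∈ T <;>
      simp [hi, h1, h2, h, h']
  have hin_sum : ∑ d, M.inside T d = ∑ d, i d + ∑ d, M.leaving T d := by
    rw [← Finset.sum_add_distrib]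
    exact Finset.sum_congr rfl fun d _ => hin d
  have hcross : ∑ d, M.crossing T d = 2 * ∑ d, M.leaving T d := by
    simpa using sum_crossing_mul (M := M) (T := T) fun _ => 1
  have hdef : ∑ v, M.defect R T v = 2 * ∑ d, M.inside T d - ∑ d, M.inside T d * R.corner d -
      ∑ d, M.crossing T d - 4 * (M.interior T).card := by
    have h1 : ∑ v, ∑ d with G.tail d = v, (M.inside T d * (2 - R.corner d) - M.crossing T d) =
        ∑ d, (M.inside T d * (2 - R.corner d) - M.crossing T d) :=
      Finset.sum_fiberwise _ _ _
    simp only [defect]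
    rw [Finset.sum_sub_distrib, h1, ← Finset.mul_sum, Finset.sum_boole,
      Finset.filter_mem_eq_inter, Finset.univ_inter, Finset.mul_sum, ← Finset.sum_sub_distrib,
      ← Finset.sum_sub_distrib]
    congr 1
    exact Finset.sum_congr rfl fun d _ => by ring
  rw [hdef]
  linarith

open scoped Classical in
/-- The defect of a vertex that is not in the interior, in terms of the angles outside of `T`. -/
theorem defect_eq_of_notMem [Fintype V] (hR : M.IsOrthRep R) {v : V} (hv : v ∉ M.interior T) :
    M.defect R T v = 4 - ∑ d with G.tail d = v, M.crossing T d +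
      ∑ d with G.tail d = v, (1 - M.inside T d) * (R.corner d - 2) := by
  have h := hR.vertex_sum v
  have h2 : ∑ d with G.tail d = v, (2 : ℤ) = 2 * G.deg v := by
    rw [Finset.sum_const, ← deg_eq_card, nsmul_eq_mul, mul_comm]
  rw [defect, if_neg hv, mul_zero, sub_zero, Finset.sum_sub_distrib]
  have : ∑ d with G.tail d = v, M.inside T d * (2 - R.corner d) =
      ∑ d with G.tail d = v, (1 - M.inside T d) * (R.corner d - 2) +
      ∑ d with G.tail d = v, (2 : ℤ) - ∑ d with G.tail d = v, R.corner d := by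
    rw [← Finset.sum_add_distrib, ← Finset.sum_sub_distrib]
    exact Finset.sum_congr rfl fun d _ => by ring
  rw [this, h2, h]
  ring

open scoped Classical in
theorem one_le_sum_crossing {v : V} {e : Dart E} (he : G.tail e = v)
    (h : ¬ (M.region e ∈ T ↔ M.region (Dart.rev e) ∈ T)) :
    1 ≤ ∑ d with G.tail d = v, M.crossing T d := by
  rw [← crossing_eq_one h]
  exact Finset.single_le_sum (fun d _ => crossing_nonneg d) (by simpa using he)

theorem inside_term_nonpos (hR : M.IsOrthRep R) (d : Dart E) :
    (1 - M.inside T d) * (R.corner d - 2) ≤ 0 := by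
  have := (hR.corner_mem d).2
  unfold inside
  split_ifs <;> simp
  linarith

/-- At `s`, the angle `ds` on the outer face lies outside of the barrier. -/
theorem IsBarrier.defect_s [Fintype V] (hT : M.IsBarrier flex R T) {σ τ : ℕ}
    (hR : M.IsValidOrthRep flex σ τ R) (hst : s ≠ t) : M.defect R T s ≤ (σ : ℤ) - 2 := by
  classical
  obtain ⟨e, he, he'⟩ := hT.exists_boundary_s hst
  have h1 := one_le_sum_crossing he he'
  rw [defect_eq_of_notMem hR.toIsOrthRep (by simp [interior])]
  have hmem : M.ds ∈ Finset.univ.filter fun d => G.tail d = s := by simp [M.tail_ds]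
  have h2 : ∑ d ∈ (Finset.univ.filter fun d => G.tail d = s).erase M.ds,
      (1 - M.inside T d) * (R.corner d - 2) ≤ 0 :=
    Finset.sum_nonpos fun d _ => inside_term_nonpos hR.toIsOrthRep d
  have h3 : M.inside T M.ds = 0 := if_neg (M.region_ds ▸ hT.outer_notMem)
  rw [← Finset.add_sum_erase _ (fun d => (1 - M.inside T d) * (R.corner d - 2)) hmem, h3,
    hR.occupied_s]
  linarith

theorem IsBarrier.defect_t [Fintype V] (hT : M.IsBarrier flex R T) (hR : M.IsOrthRep R)
    (hst : s ≠ t) : M.defect R T t ≤ 3 := by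
  classical
  obtain ⟨e, he, he'⟩ := hT.exists_boundary_t hst
  have h1 := one_le_sum_crossing he he'
  rw [defect_eq_of_notMem hR (by simp [interior])]
  have h2 : ∑ d with G.tail d = t, (1 - M.inside T d) * (R.corner d - 2) ≤ 0 :=
    Finset.sum_nonpos fun d _ => inside_term_nonpos hR d
  linarith

open scoped Classical in
/-- The vertices of degree 4 on the boundary of `T`, except for the poles. -/
noncomputable def fullBoundary [Fintype V] (M : G.STEmbedding s t) (T : Finset (Option M.Face)) :
    Finset V :=
  Finset.univ.filter fun v => v ≠ s ∧ v ≠ t ∧ G.deg v = 4 ∧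
    ∃ d, G.tail d = v ∧ ¬ (M.region d ∈ T ↔ M.region (Dart.rev d) ∈ T)

/-- The boundary crosses a vertex at least twice: it enters and it leaves. -/
theorem exists_two_boundary_darts {d d' : Dart E} (hs : G.tail d ≠ s) (ht : G.tail d ≠ t)
    (hd : M.region d ∈ T) (hd' : M.region d' ∉ T) (h : G.tail d' = G.tail d) :
    ∃ e e', e ≠ e' ∧ G.tail e = G.tail d ∧ G.tail e' = G.tail d ∧
      ¬ (M.region e ∈ T ↔ M.region (Dart.rev e) ∈ T) ∧
      ¬ (M.region e' ∈ T ↔ M.region (Dart.rev e') ∈ T) := by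
  obtain ⟨e, he, he1, he2⟩ := exists_leaving hs ht hd hd' h
  obtain ⟨e', he', he1', he2'⟩ := exists_entering hs ht hd hd' h
  refine ⟨e, e', ?_, he, he', by tauto, by tauto⟩
  rintro rfl
  exact he1' he1

open scoped Classical in
/-- An interior vertex has defect 0.  At a boundary vertex of degree `n`, at most `n - 1 ≤ 3` angles,
all with rotation 1, lie inside, and the boundary costs at least 2. -/
theorem IsBarrier.defect_le [Fintype V] (hT : M.IsBarrier flex R T) (hR : M.IsOrthRep R) {v : V}
    (hs : v ≠ s) (ht : v ≠ t) : M.defect R T v ≤ if v ∈ M.fullBoundary T then 1 else 0 := by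
  have hnonneg : (0 : ℤ) ≤ if v ∈ M.fullBoundary T then 1 else 0 := by
    split_ifs <;> norm_num
  by_cases hall : ∀ d, G.tail d = v → M.region d ∈ T
  · have hU : v ∈ M.interior T := by
      simpa [interior, hs, ht] using fun e => ⟨hall (e, false), hall (e, true)⟩
    refine le_of_eq_of_le ?_ hnonneg
    have h1 : ∑ d with G.tail d = v, (M.inside T d * (2 - R.corner d) - M.crossing T d) =
        ∑ d with G.tail d = v, (2 - R.corner d) := by
      refine Finset.sum_congr rfl fun d hd => ?_
      replace hd : G.tail d = v := by simpa using hd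
      have hr : M.region (Dart.rev d) ∈ T := by
        rw [← M.region_next (hd ▸ hs) (hd ▸ ht)]
        exact hall _ ((M.tail_next d).trans hd)
      rw [crossing_eq_zero (iff_of_true (hall d hd) hr), inside, if_pos (hall d hd)]
      ring
    rw [defect, if_pos hU, h1, Finset.sum_sub_distrib, hR.vertex_sum, Finset.sum_const,
      ← deg_eq_card, nsmul_eq_mul]
    ring
  push Not at hall
  obtain ⟨d', htd', hd'⟩ := hall
  have hU : v ∉ M.interior T := by
    simp only [interior, Finset.mem_filter, Finset.mem_univ, true_and, not_and]
    exact fun _ _ h => hd' (h d' htd')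
  rw [defect, if_neg hU, mul_zero, sub_zero]
  by_cases hnone : ∀ d, G.tail d = v → M.region d ∉ T
  · refine le_of_eq_of_le (Finset.sum_eq_zero fun d hd => ?_) hnonneg
    replace hd : G.tail d = v := by simpa using hd
    have hr : M.region (Dart.rev d) ∉ T := by
      rw [← M.region_next (hd ▸ hs) (hd ▸ ht)]
      exact hnone _ ((M.tail_next d).trans hd)
    rw [crossing_eq_zero (iff_of_false (hnone d hd) hr), inside, if_neg (hnone d hd)]
    ring
  push Not at hnone
  obtain ⟨d, htd, hd⟩ := hnone
  subst htd
  obtain ⟨e, e', hne, hte, hte', he, he'⟩ := exists_two_boundary_darts hs ht hd hd' htd'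
  have h2 : 2 ≤ ∑ x with G.tail x = G.tail d, M.crossing T x := by
    have hsub : ({e, e'} : Finset (Dart E)) ⊆ Finset.univ.filter fun x => G.tail x = G.tail d := by
      intro x hx
      simp only [Finset.mem_insert, Finset.mem_singleton] at hx
      rw [Finset.mem_filter]
      rcases hx with rfl | rfl
      exacts [⟨Finset.mem_univ _, hte⟩, ⟨Finset.mem_univ _, hte'⟩]
    refine le_trans ?_ (Finset.sum_le_sum_of_subset_of_nonneg hsub fun x _ _ => crossing_nonneg x)
    rw [Finset.sum_pair hne, crossing_eq_one he, crossing_eq_one he']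
    norm_num
  have h1 : ∑ x with G.tail x = G.tail d, M.inside T x * (2 - R.corner x) ≤
      (G.deg (G.tail d) : ℤ) - 1 := by
    have hmem : d' ∈ Finset.univ.filter fun x => G.tail x = G.tail d := by simpa using htd'
    rw [← Finset.add_sum_erase _ _ hmem, inside, if_neg hd', zero_mul, zero_add]
    have hc := Finset.card_erase_add_one hmem
    rw [← deg_eq_card] at hc
    rw [← hc, Nat.cast_add, Nat.cast_one, add_sub_cancel_right, ← nsmul_one, ← Finset.sum_const]
    refine Finset.sum_le_sum fun x hx => ?_
    have hx' : G.tail x = G.tail d := by simpa using Finset.mem_of_mem_erase hx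
    unfold inside
    split_ifs with hxT
    · rw [hT.corner_eq_one hR (hx' ▸ hs) (hx' ▸ ht) hxT hd' (htd'.trans hx'.symm)]
      norm_num
    · norm_num
  rw [Finset.sum_sub_distrib]
  have h4 := deg_le_four hR (G.tail d)
  split_ifs with hN
  · omega
  · have : G.deg (G.tail d) ≠ 4 := fun h => hN (by
      rw [fullBoundary, Finset.mem_filter]
      exact ⟨Finset.mem_univ _, hs, ht, h, e, hte, he⟩)
    omega

open scoped Classical in
theorem IsBarrier.sum_defect_le [Fintype V] (hT : M.IsBarrier flex R T) {σ τ : ℕ}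
    (hR : M.IsValidOrthRep flex σ τ R) (hst : s ≠ t) :
    ∑ v, M.defect R T v ≤ (σ : ℤ) + 1 + (M.fullBoundary T).card := by
  have h1 : ∀ v, M.defect R T v ≤ ((if v ∈ M.fullBoundary T then 1 else 0) +
      (if v = s then (σ : ℤ) - 2 else 0)) + if v = t then 3 else 0 := by
    intro v
    by_cases hs : v = s
    · have hN : v ∉ M.fullBoundary T := by simp [fullBoundary, hs]
      subst hs
      simpa [hN, hst] using hT.defect_s hR hst
    by_cases ht : v = t
    · have hN : v ∉ M.fullBoundary T := by simp [fullBoundary, ht]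
      subst ht
      simpa [hN, hs] using hT.defect_t hR.toIsOrthRep hst
    simpa [hs, ht] using hT.defect_le hR.toIsOrthRep hs ht
  refine (Finset.sum_le_sum fun v _ => h1 v).trans_eq ?_
  rw [Finset.sum_add_distrib, Finset.sum_add_distrib, Finset.sum_ite_eq' , Finset.sum_ite_eq',
    Finset.sum_boole, Finset.filter_mem_eq_inter, Finset.univ_inter]
  simp
  ring

open scoped Classical in
/-- The boundary edges that are flexible or critical are at least as many as the non-pole vertices of
degree 4 on the boundary, each of which has two of them.  There is one more if such an edge ends at
a pole. -/
theorem fullBoundary_card_le [Fintype V] {k : ℕ} (hk : G.IsKCritical s t flex k) :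
    ((M.fullBoundary T).card : ℤ) ≤ ∑ d, M.leaving T d * (flex d.1 : ℤ) + k ∧
    ∀ e, (G.tail e = s ∨ G.tail e = t) → ¬ (M.region e ∈ T ↔ M.region (Dart.rev e) ∈ T) →
      (flex e.1 ≠ 0 ∨ G.IsCritical s t flex e.1) →
      ((M.fullBoundary T).card : ℤ) + 1 ≤ ∑ d, M.leaving T d * (flex d.1 : ℤ) + k := by
  -- `g` counts the flexible or critical edges, and `κ` the critical ones
  let g : E → ℤ := fun e => if flex e ≠ 0 ∨ G.IsCritical s t flex e then 1 else 0
  let κ : E → ℤ := fun e => if G.IsCritical s t flex e then 1 else 0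
  have hg0 : ∀ e, 0 ≤ g e := fun e => by
    simp only [g]
    split_ifs <;> norm_num
  have hκ0 : ∀ e, 0 ≤ κ e := fun e => by
    simp only [κ]
    split_ifs <;> norm_num
  have hκ : ∑ e, κ e = k := by
    rw [Finset.sum_boole, ← hk, ← Set.ncard_coe_finset]
    congr 2
    ext e
    simp
  have hup : ∑ d, M.leaving T d * g d.1 ≤ ∑ d, M.leaving T d * (flex d.1 : ℤ) + k := by
    have h1 : ∀ e, g e ≤ flex e + κ e := by
      intro e
      simp only [g, κ]
      split_ifs with h h' h' <;> first | omega | (exfalso; tauto) | skip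
      have : flex e ≠ 0 := h.resolve_right h'
      omega
    refine le_trans ?_ (add_le_add_right ((sum_leaving_mul_le (M := M) (T := T) hκ0).trans_eq hκ) _)
    rw [← Finset.sum_add_distrib]
    refine Finset.sum_le_sum fun d _ => ?_
    rw [← mul_add]
    exact mul_le_mul_of_nonneg_left (h1 _) (leaving_nonneg d)
  have hterm : ∀ d, 0 ≤ M.crossing T d * g d.1 := fun d => mul_nonneg (crossing_nonneg d) (hg0 _)
  have hfib : ∑ v, ∑ d with G.tail d = v, M.crossing T d * g d.1 =
      2 * ∑ d, M.leaving T d * g d.1 :=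
    (Finset.sum_fiberwise _ _ _).trans (sum_crossing_mul g)
  have hN : ∀ v ∈ M.fullBoundary T, 2 ≤ ∑ d with G.tail d = v, M.crossing T d * g d.1 := by
    intro v hv
    rw [fullBoundary, Finset.mem_filter] at hv
    obtain ⟨-, hs, ht, hdeg, d, rfl, hd⟩ := hv
    obtain ⟨e, e', hne, hte, hte', he, he'⟩ : ∃ e e', e ≠ e' ∧ G.tail e = G.tail d ∧
        G.tail e' = G.tail d ∧ ¬ (M.region e ∈ T ↔ M.region (Dart.rev e) ∈ T) ∧
        ¬ (M.region e' ∈ T ↔ M.region (Dart.rev e') ∈ T) := by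
      have htn := M.tail_next d
      rw [← M.region_next hs ht] at hd
      by_cases h : M.region d ∈ T
      · exact exists_two_boundary_darts hs ht h (by tauto) htn
      · have := exists_two_boundary_darts (htn ▸ hs) (htn ▸ ht) (by tauto : M.region (M.next d) ∈ T) h
          htn.symm
        rwa [htn] at this
    have hone : ∀ x, G.tail x = G.tail d → ¬ (M.region x ∈ T ↔ M.region (Dart.rev x) ∈ T) →
        M.crossing T x * g x.1 = 1 := by
      intro x hx hx'
      rw [crossing_eq_one hx', one_mul]
      refine if_pos ?_
      by_cases h0 : flex x.1 = 0
      · exact Or.inr ⟨h0, x.2, Or.inl ((congrArg G.deg hx).trans hdeg)⟩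
      · exact Or.inl h0
    have hsub : ({e, e'} : Finset (Dart E)) ⊆ Finset.univ.filter fun x => G.tail x = G.tail d := by
      intro x hx
      simp only [Finset.mem_insert, Finset.mem_singleton] at hx
      rw [Finset.mem_filter]
      rcases hx with rfl | rfl
      exacts [⟨Finset.mem_univ _, hte⟩, ⟨Finset.mem_univ _, hte'⟩]
    refine le_trans ?_ (Finset.sum_le_sum_of_subset_of_nonneg hsub fun x _ _ => hterm x)
    rw [Finset.sum_pair hne, hone e hte he, hone e' hte' he']
    norm_num
  have hNsum : ∑ v ∈ M.fullBoundary T, (2 : ℤ) = 2 * (M.fullBoundary T).card := by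
    rw [Finset.sum_const, nsmul_eq_mul, mul_comm]
  have hle := Finset.sum_le_sum hN
  rw [hNsum] at hle
  constructor
  · have := Finset.sum_le_sum_of_subset_of_nonneg (Finset.subset_univ (M.fullBoundary T))
      fun v _ _ => Finset.sum_nonneg (s := Finset.univ.filter fun d => G.tail d = v)
        fun d _ => hterm d
    linarith
  · intro e he he' heg
    have hnot : G.tail e ∉ M.fullBoundary T := by
      rw [fullBoundary, Finset.mem_filter]
      tauto
    have h1 : 1 ≤ ∑ d with G.tail d = G.tail e, M.crossing T d * g d.1 := by
      have h2 : M.crossing T e * g e.1 = 1 := by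
        rw [crossing_eq_one he', one_mul]
        exact if_pos heg
      rw [← h2]
      exact Finset.single_le_sum (f := fun d : Dart E => M.crossing T d * g d.1)
        (fun d _ => hterm d) (by simp)
    have := Finset.sum_le_sum_of_subset_of_nonneg
      (Finset.subset_univ (insert (G.tail e) (M.fullBoundary T)))
      fun v _ _ => Finset.sum_nonneg (s := Finset.univ.filter fun d => G.tail d = v)
        fun d _ => hterm d
    rw [Finset.sum_insert hnot] at this
    omega

/-- A pole of degree 1 has an angle of 360 degrees, that is, one occupied incidence. -/
theorem occupied_eq_one (hR : M.IsOrthRep R) {d : Dart E} {n : ℕ} (hd : R.corner d = (n : ℤ) - 3)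
    (h : G.deg (G.tail d) ≤ 1) : n = 1 := by
  classical
  have hs := hR.vertex_sum (G.tail d)
  have hmem : d ∈ Finset.univ.filter fun x => G.tail x = G.tail d := by simp
  have hcard := deg_eq_card (G := G) (G.tail d)
  obtain ⟨a, ha⟩ := Finset.card_eq_one.1
    (le_antisymm (hcard ▸ h) (Finset.card_pos.2 ⟨d, hmem⟩))
  rw [hcard] at hs
  rw [ha, Finset.mem_singleton] at hmem
  subst hmem
  have h1 : ∑ x with G.tail x = G.tail d, R.corner x = R.corner d := by
    rw [ha, Finset.sum_singleton]
  have hs' : ∑ x with G.tail x = G.tail d, R.corner x = 2 * (1 : ℤ) - 4 := by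
    convert hs using 3
    rw [ha]
    rfl
  omega

/-- If a barrier exists, the rotation of `π(t, s)` is bounded.  The first bound holds if a boundary edge
at a pole is flexible or critical; otherwise both poles have degree 1. -/
theorem IsBarrier.neg_rotTS_bound [Fintype V] (hT : M.IsBarrier flex R T) {σ τ k : ℕ}
    (hR : M.IsValidOrthRep flex σ τ R) (hk : G.IsKCritical s t flex k) (hst : s ≠ t)
    (hG : (G.addEdge s t hst).toSimpleGraph.Connected) :
    -M.rotTS R ≤ (σ : ℤ) + τ - 3 + k ∨ σ = 1 ∧ τ = 1 ∧ -M.rotTS R ≤ k := by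
  have h1 := hT.neg_rotTS_le hR hst hG
  have h2 := hT.sum_defect_le hR hst
  obtain ⟨h3, h4⟩ := fullBoundary_card_le (M := M) (T := T) hk
  obtain ⟨e, he, heb⟩ := hT.exists_boundary_s hst
  obtain ⟨e', he', heb'⟩ := hT.exists_boundary_t hst
  by_cases hgood : flex e.1 ≠ 0 ∨ G.IsCritical s t flex e.1
  · have := h4 e (Or.inl he) heb hgood
    left
    linarith
  by_cases hgood' : flex e'.1 ≠ 0 ∨ G.IsCritical s t flex e'.1
  · have := h4 e' (Or.inr he') heb' hgood'
    left
    linarith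
  -- an inflexible edge at a pole is critical unless the pole has degree 1
  have key : ∀ x : Dart E, (G.tail x = s ∨ G.tail x = t) →
      ¬ (flex x.1 ≠ 0 ∨ G.IsCritical s t flex x.1) → G.deg (G.tail x) ≤ 1 := by
    intro x hx hgx
    by_contra! hlt
    refine hgx (or_iff_not_imp_left.2 fun h0 => ⟨not_not.1 h0, x.2, Or.inr ⟨hx, hlt⟩⟩)
  have hσ : σ = 1 := occupied_eq_one hR.toIsOrthRep hR.occupied_s
    (by rw [M.tail_ds, ← he]; exact key e (Or.inl he) hgood)
  have hτ : τ = 1 := occupied_eq_one hR.toIsOrthRep hR.occupied_t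
    (by rw [M.tail_dt, ← he']; exact key e' (Or.inr he') hgood')
  subst hσ hτ
  right
  refine ⟨rfl, rfl, ?_⟩
  push_cast at h1 h2
  linarith

end STEmbedding

end Multigraph

theorem add_le_two_mul_betaLow (σ τ : ℕ) : (σ : ℤ) + τ ≤ 2 * (betaLow σ τ + 1) := by
  have h := Int.le_ceil (((σ : ℚ) + τ) / 2)
  have : ((σ : ℚ) + τ) ≤ 2 * (⌈((σ : ℚ) + τ) / 2⌉ : ℤ) := by linarith
  rw [betaLow, sub_add_cancel]
  exact_mod_cast this

theorem mainTheorem4 {V E : Type*} [Fintype V] [Fintype E]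
    (G : Multigraph V E) (s t : V) (hG : G.IsSTGraph s t)
    (flex : E → ℕ) (k : ℕ) (hk : G.IsKCritical s t flex k)
    (M : G.STEmbedding s t) (σ τ : ℕ) (R : Multigraph.Rotations E)
    (hR : M.IsValidOrthRep flex σ τ R) :
    (σ + τ ≤ 5 → -M.rotTS R ≥ betaLow σ τ + k + 1 →
      M.ExistsReducingCycle flex σ τ R) ∧
    (σ = 3 → τ = 3 → -M.rotTS R ≥ betaLow σ τ + k + 2 →
      M.ExistsReducingCycle flex σ τ R) := by
  obtain ⟨hst, hbi, -⟩ := hG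
  by_cases h : M.Reaches flex R (some M.outer)
  · have := Multigraph.STEmbedding.existsReducingCycle_of_reaches hst hR h
    exact ⟨fun _ _ => this, fun _ _ _ => this⟩
  obtain ⟨T, hT⟩ := Multigraph.STEmbedding.exists_isBarrier h
  have hbound := hT.neg_rotTS_bound hR hk hst hbi.1
  have hβ := add_le_two_mul_betaLow σ τ
  have hσ := (hR.corner_mem M.ds).1
  have hτ := (hR.corner_mem M.dt).1
  rw [hR.occupied_s] at hσ
  rw [hR.occupied_t] at hτ
  constructor
  · intro h1 h2
    exfalso
    omega
  · intro h1 h2 h3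
    exfalso
    omega
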